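/- Let $\mathbb{D}$ be the open unit disk in $\mathbb{C}$, and let $dA=\frac1\pi\,dx\,dy$ be normalized Lebesgue measure on $\mathbb{D}$. For $\gamma>-1$ put $dA_\gamma(z)=(1+\gamma)(1-|z|^2)^\gamma\,dA(z)$. For $0<p<\infty$ and $\gamma>-1$ let $A^p_\gamma$ be the weighted Bergman space of all holomorphic $f$ on $\mathbb{D}$ with $\|f\|_{p,\gamma}=\left(\int_{\mathbb{D}}|f|^p\,dA_\gamma\right)^{1/p}<\infty$, and let $A^p_{-1}=H^p$ be the Hardy space of all holomorphic $f$ on $\mathbb{D}$ with $\|f\|_{p,-1}=\sup_{0\le r<1}\left(\frac1{2\pi}\int_0^{2\pi}|f(re^{i\theta})|^p\,d\theta\right)^{1/p}<\infty$. Let $p,q\in(0,\infty)$, $\alpha\in[-1,\infty)$, $\beta\in(-1,\infty)$, and let $n$ be a positive integer. Let $u_0,\dots,u_n$ be holomorphic functions on $\mathbb{D}$ and let $\varphi_0,\dots,\varphi_n$ be holomorphic maps from $\mathbb{D}$ into $\mathbb{D}$. For holomorphic $f$ on $\mathbb{D}$ put $D^k_{u_k,\varphi_k}f=u_k\cdot(f^{(k)}\circ\varphi_k)$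 and $T=\sum_{k=0}^n D^k_{u_k,\varphi_k}$. Call an operator $S$ order bounded from $A^p_\alpha$ to $A^q_\beta$ if it maps $A^p_\alpha$ into $A^q_\beta$ and there is a function $h\in L^q(\mathbb{D},dA_\beta)$ such that $|Sf(z)|\le h(z)$ for all $z\in\mathbb{D}$ and all $f\in A^p_\alpha$ with $\|f\|_{p,\alpha}<1$. Then the following are equivalent: (a) $T$ is order bounded from $A^p_\alpha$ to $A^q_\beta$; (b) for each $0\le k\le n$, the operator $D^k_{u_k,\varphi_k}$ is order bounded from $A^p_\alpha$ to $A^q_\beta$; (c) for each $0\le k\le n$, $$\int_{\mathbb{D}}\frac{|u_k(z)|^q}{(1-|\varphi_k(z)|^2)^{(2+\alpha)\frac qp+kq}}\,dA_\beta(z)<\infty.$$ -/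

import Mathlib

open MeasureTheory Set
open scoped ENNReal

noncomputable section

namespace WeightedBergman

/-- The open unit disk of the complex plane. -/
def disk : Set ℂ := Metric.ball 0 1

/-- The measure `dA_α(z) = (1 + α) (1 - |z|²)^α dA(z)` on the unit disk, where `dA = π⁻¹ dx dy`
is normalized Lebesgue measure (viewed as a measure on `ℂ` carried by the disk). -/
def dA (α : ℝ) : Measure ℂ :=
  (volume.restrict disk).withDensity
    fun z => ENNReal.ofReal ((1 + α) * (1 - ‖z‖ ^ 2) ^ α / Real.pi)

/-- Normalized arc length `dθ / 2π` on the unit circle, in the angular parameter. -/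
def arcMeasure : Measure ℝ :=
  (ENNReal.ofReal (2 * Real.pi))⁻¹ • volume.restrict (Ioc 0 (2 * Real.pi))

/-- The Hardy (quasi-)norm: the supremum over `0 ≤ r < 1` of the `L^p` means of `f` on the circle
of radius `r` about `0`. -/
def hardyNorm (p : ℝ) (f : ℂ → ℂ) : ℝ≥0∞ :=
  ⨆ r ∈ Ico (0 : ℝ) 1, eLpNorm (fun θ : ℝ => f (circleMap 0 r θ)) (ENNReal.ofReal p) arcMeasure

open Classical in
/-- The (quasi-)norm `‖f‖_{p,α}`, with values in `[0, ∞]`: the Hardy norm for `α = -1`, and the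
`L^p(dA_α)` norm otherwise. -/
def bergmanNorm (p α : ℝ) (f : ℂ → ℂ) : ℝ≥0∞ :=
  if α = -1 then hardyNorm p f else eLpNorm f (ENNReal.ofReal p) (dA α)

/-- The space `A^p_α` of holomorphic functions on the disk with finite `‖f‖_{p,α}`; in particular
`A^p_{-1} = H^p`. -/
def bergmanSpace (p α : ℝ) : Set (ℂ → ℂ) :=
  {f | DifferentiableOn ℂ f disk ∧ bergmanNorm p α f < ∞}

/-- The operator `D^k_{u,φ} f = u · (f^{(k)} ∘ φ)`. -/
def diffComp (k : ℕ) (u φ : ℂ → ℂ) (f : ℂ → ℂ) : ℂ → ℂ :=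
  fun z => u z * iteratedDeriv k f (φ z)

/-- The operator `T = ∑_{k=0}^n D^k_{u_k,φ_k}`. -/
def sumDiffComp (n : ℕ) (u φ : Fin (n + 1) → ℂ → ℂ) (f : ℂ → ℂ) : ℂ → ℂ :=
  fun z => ∑ k : Fin (n + 1), diffComp k (u k) (φ k) f z

/-- `T` is an order bounded operator from `A^p_α` to `A^q_β`: it maps `A^p_α` into `A^q_β`, and
there is `h ∈ L^q(dA_β)` with `|T f(z)| ≤ h(z)` for all `f ∈ A^p_α` with `‖f‖_{p,α} < 1` and all
`z` in the disk. -/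
def OrderBounded (p α q β : ℝ) (T : (ℂ → ℂ) → (ℂ → ℂ)) : Prop :=
  MapsTo T (bergmanSpace p α) (bergmanSpace q β) ∧
    ∃ h : ℂ → ℝ, MemLp h (ENNReal.ofReal q) (dA β) ∧
      ∀ f ∈ bergmanSpace p α, bergmanNorm p α f < 1 → ∀ z ∈ disk, ‖T f z‖ ≤ h z

end WeightedBergman

end

/-! Write s = (2+α)/p. The proof compares the normalized functionals f ↦ (1-|w|²)^{s+k} f^{(k)}(w)
on A^p_α.

They are uniformly bounded (`exists_norm_iteratedDeriv_le_bergmanNorm`), by the sub-mean value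
property of |f|^p followed by Cauchy's estimates. Hence a multiple of |u_k| (1-|φ_k|²)^{-(s+k)}
majorizes the k-th operator on the unit ball, and (c) says that this function lies in L^q(dA_β). So
(c) gives (b), and adding majorants gives (a).

The substance is (a) ⇒ (c), where cancellation between the terms of T must be excluded. Fix z, put
w_j = φ_j(z) and X_j = u_j(z)/(1-|w_j|²)^{s+j}. The goal is an f in the unit ball with |Tf(z)| ≥ c
max |X_j|, where c does not depend on z or on the position of the w_j (`exists_test_function`). Let
|X_k| be maximal. Take f to be the normalized kernel at w_k times a bounded H. One factor of H is a
product of Möbius factors to the power n+1, which removes the terms at points far from w_k. The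
other makes the normalized k-th derivative at w_k equal to 1 and the others of order at most n zero
(`exists_jet`). Points very near w_k then contribute little, since normalized derivatives vary
slowly (`norm_iteratedDeriv_sub_le_of_growth`).

How near is near enough depends on the size of H, hence on the separation of the far points. A point
in neither class is added to the far set, with a smaller separation constant, and the argument is
repeated; with n+1 indices this stops, and all constants depend on s and n only. -/

namespace WeightedBergman

/-! ### Sub-mean value inequalities for |f|^p -/

/-- Jensen's inequality `log |f(c)| ≤ avg log |f|` for holomorphic functions. -/
lemma log_norm_le_circleAverage {f : ℂ → ℂ} {c : ℂ} {R : ℝ} (hR : 0 < R)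
    (hf : AnalyticOnNhd ℂ f (Metric.closedBall c R)) (hfc : f c ≠ 0) :
    Real.log ‖f c‖ ≤ Real.circleAverage (fun z => Real.log ‖f z‖) c R := by
  have hf' : AnalyticOnNhd ℂ f (Metric.closedBall c |R|) := by rwa [abs_of_pos hR]
  rw [hf'.circleAverage_log_norm hR.ne' hfc]
  -- This sum over the zeros is exactly the gap in Jensen's formula.
  have : 0 ≤ ∑ᶠ u, (MeromorphicOn.divisor f (Metric.closedBall c |R|) u : ℝ) *
      Real.log (R * ‖c - u‖⁻¹) := by
    refine finsum_nonneg fun u => ?_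
    by_cases hu : u ∈ Metric.closedBall c |R|
    · refine mul_nonneg ?_ ?_
      · exact_mod_cast MeromorphicOn.AnalyticOnNhd.divisor_nonneg hf' u
      · by_cases huc : u = c
        · simp [huc]
        · have h0 : 0 < ‖c - u‖ := norm_pos_iff.2 (sub_ne_zero.2 (Ne.symm huc))
          refine Real.log_nonneg ?_
          rw [← div_eq_mul_inv, one_le_div h0]
          rw [abs_of_pos hR, mem_closedBall_iff_norm, norm_sub_rev] at hu
          exact hu
    · simp [hu]
  linarith

/-- The sub-mean value inequality for `|f|^p`. -/
lemma norm_rpow_le_circleAverage {f : ℂ → ℂ} {c : ℂ} {R p : ℝ} (hR : 0 < R) (hp : 0 < p)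
    (hf : AnalyticOnNhd ℂ f (Metric.closedBall c R)) :
    ‖f c‖ ^ p ≤ Real.circleAverage (fun z => ‖f z‖ ^ p) c R := by
  by_cases hfc : f c = 0
  · rw [hfc, norm_zero, Real.zero_rpow hp.ne']
    exact Real.circleAverage_nonneg_of_nonneg fun z _ => by positivity
  have hsphere : Metric.sphere c |R| ⊆ Metric.closedBall c R := by
    rw [abs_of_pos hR]; exact Metric.sphere_subset_closedBall
  have hlog : CircleIntegrable (fun z => Real.log ‖f z‖) c R :=
    (hf.mono hsphere).meromorphicOn.circleIntegrable_log_norm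
  have hcont : Continuous fun θ : ℝ => ‖f (circleMap c R θ)‖ := by
    refine continuous_norm.comp ?_
    refine hf.continuousOn.comp_continuous (continuous_circleMap c R) fun θ => ?_
    exact Metric.sphere_subset_closedBall (circleMap_mem_sphere c hR.le θ)
  have hcontp : Continuous fun θ : ℝ => ‖f (circleMap c R θ)‖ ^ p :=
    hcont.rpow_const fun _ => Or.inr hp.le
  -- Since `Real.log 0 = 0`, the identity exp(p log|f|) = |f|^p fails at zeros of f; on the circle
  -- these form a null set. Jensen's inequality for x ↦ exp(p x) can then be applied to log|f|, for
  -- every p > 0.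
  have hae : ∀ᵐ θ : ℝ ∂volume.restrict (Ioc 0 (2 * Real.pi)), f (circleMap c R θ) ≠ 0 := by
    have h0 : f ⁻¹' {0}ᶜ ∈ Filter.codiscreteWithin (Metric.closedBall c R) :=
      hf.preimage_zero_mem_codiscreteWithin hfc (Metric.mem_closedBall_self hR.le)
        ((convex_closedBall c R).isConnected ⟨c, Metric.mem_closedBall_self hR.le⟩)
    have h1 := circleMap_preimage_codiscrete hR.ne' (Filter.codiscreteWithin_mono hsphere h0)
    exact ae_restrict_le_codiscreteWithin measurableSet_Ioc
      (Filter.codiscreteWithin_mono (subset_univ _) h1)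
  have hpi : (0:ℝ) < 2 * Real.pi := by positivity
  have : NeZero (volume.restrict (Ioc 0 (2 * Real.pi))) := ⟨by
    rw [Ne, Measure.restrict_eq_zero]; simp [Real.volume_Ioc, Real.pi_pos]⟩
  have hexp : (fun θ => Real.exp (p * Real.log ‖f (circleMap c R θ)‖))
      =ᵐ[volume.restrict (Ioc 0 (2 * Real.pi))] fun θ => ‖f (circleMap c R θ)‖ ^ p := by
    filter_upwards [hae] with θ hθ
    rw [Real.rpow_def_of_pos (norm_pos_iff.2 hθ), mul_comm]
  have hg : ConvexOn ℝ univ fun x : ℝ => Real.exp (p * x) := by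
    have := convexOn_exp.comp_linearMap (LinearMap.lsmul ℝ ℝ p)
    simpa [Function.comp_def] using! this
  have hint : IntegrableOn (fun θ => ‖f (circleMap c R θ)‖ ^ p) (Ioc 0 (2 * Real.pi)) :=
    (hcontp.integrableOn_Icc).mono_set Ioc_subset_Icc_self
  have hlogint : IntegrableOn (fun θ => Real.log ‖f (circleMap c R θ)‖) (Ioc 0 (2 * Real.pi)) := by
    have := hlog
    rw [CircleIntegrable, intervalIntegrable_iff_integrableOn_Ioc_of_le hpi.le] at this
    exact this
  have key := hg.map_average_le (μ := volume.restrict (Ioc 0 (2 * Real.pi)))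
    (f := fun θ => Real.log ‖f (circleMap c R θ)‖)
    (by fun_prop) isClosed_univ (by simp) hlogint (hint.congr hexp.symm)
  have h1 : Real.circleAverage (fun z => ‖f z‖ ^ p) c R =
      ⨍ θ in Ioc 0 (2 * Real.pi), Real.exp (p * Real.log ‖f (circleMap c R θ)‖) := by
    rw [average_congr hexp, Real.circleAverage_eq_intervalAverage, uIoc_of_le hpi.le]
  have h2 : Real.circleAverage (fun z => Real.log ‖f z‖) c R =
      ⨍ θ in Ioc 0 (2 * Real.pi), Real.log ‖f (circleMap c R θ)‖ := by
    rw [Real.circleAverage_eq_intervalAverage, uIoc_of_le hpi.le]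
  rw [h1]
  refine le_trans ?_ key
  rw [← h2, Real.rpow_def_of_pos (norm_pos_iff.2 hfc), mul_comm]
  exact Real.exp_le_exp.2 (mul_le_mul_of_nonneg_left (log_norm_le_circleAverage hR hf hfc) hp.le)

/-- Integration over `ℂ` in polar coordinates. -/
lemma lintegral_eq_lintegral_circleMap {F : ℂ → ℝ≥0∞} (hF : Measurable F) :
    ∫⁻ z, F z = ∫⁻ r in Ioi (0 : ℝ), ENNReal.ofReal r *
      ∫⁻ θ in Ioc 0 (2 * Real.pi), F (circleMap 0 r θ) := by
  have hc : Continuous fun x : ℝ × ℝ => circleMap 0 x.1 x.2 := by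
    unfold circleMap; fun_prop
  have hmeas : Measurable fun x : ℝ × ℝ => F (circleMap 0 x.1 x.2) := hF.comp hc.measurable
  rw [← Complex.lintegral_comp_polarCoord_symm, polarCoord_target]
  have h1 : ∀ x : ℝ × ℝ, Complex.polarCoord.symm x = circleMap 0 x.1 x.2 := fun x => by
    rw [Complex.polarCoord_symm_apply, circleMap, Complex.exp_mul_I]; simp
  simp_rw [h1, smul_eq_mul]
  rw [Measure.volume_eq_prod, ← Measure.prod_restrict,
    lintegral_prod _ (by exact ((by fun_prop :
      Measurable fun x : ℝ × ℝ => ENNReal.ofReal x.1).mul hmeas).aemeasurable)]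
  refine lintegral_congr fun r => ?_
  have hm : Measurable fun θ => F (circleMap 0 r θ) := hF.comp (continuous_circleMap 0 r).measurable
  dsimp only
  rw [lintegral_const_mul _ hm]
  congr 1
  -- `polarCoord` has its angle in (-π, π); the two half-open intervals are fundamental domains for
  -- translation by 2π, so a periodic integrand has the same integral over both.
  have h2 := (isAddFundamentalDomain_Ioc (by positivity : (0:ℝ) < 2 * Real.pi) 0 volume)
  have h3 := (isAddFundamentalDomain_Ioc (by positivity : (0:ℝ) < 2 * Real.pi) (-Real.pi) volume)
  have h4 := h3.setLIntegral_eq h2 (fun θ => F (circleMap 0 r θ)) (by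
    rintro ⟨g, hg⟩ x
    obtain ⟨m, rfl⟩ := AddSubgroup.mem_zmultiples_iff.1 hg
    simp only [AddSubgroup.mk_vadd, vadd_eq_add]
    congr 1
    rw [add_comm]
    exact (periodic_circleMap 0 r).zsmul m x)
  rw [show -Real.pi + 2 * Real.pi = Real.pi by ring, zero_add] at h4
  rw [← h4]
  exact setLIntegral_congr Ioo_ae_eq_Ioc


lemma enorm_rpow_mul_le_lintegral_circleMap {f : ℂ → ℂ} {c : ℂ} {R p : ℝ} (hR : 0 < R) (hp : 0 < p)
    (hf : AnalyticOnNhd ℂ f (Metric.closedBall c R)) :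
    ‖f c‖ₑ ^ p * ENNReal.ofReal (2 * Real.pi) ≤
      ∫⁻ θ in Ioc 0 (2 * Real.pi), ‖f (circleMap c R θ)‖ₑ ^ p := by
  have hpi : (0 : ℝ) < 2 * Real.pi := by positivity
  have h := norm_rpow_le_circleAverage hR hp hf
  have hcont : Continuous fun θ : ℝ => ‖f (circleMap c R θ)‖ := by
    refine continuous_norm.comp ?_
    refine hf.continuousOn.comp_continuous (continuous_circleMap c R) fun θ => ?_
    exact Metric.sphere_subset_closedBall (circleMap_mem_sphere c hR.le θ)
  have hcontp : Continuous fun θ : ℝ => ‖f (circleMap c R θ)‖ ^ p :=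
    hcont.rpow_const fun _ => Or.inr hp.le
  have hint : IntegrableOn (fun θ => ‖f (circleMap c R θ)‖ ^ p) (Ioc 0 (2 * Real.pi)) :=
    (hcontp.integrableOn_Icc).mono_set Ioc_subset_Icc_self
  have henorm : ∀ z : ℂ, ‖z‖ₑ ^ p = ENNReal.ofReal (‖z‖ ^ p) := fun z => by
    rw [← ofReal_norm, ENNReal.ofReal_rpow_of_nonneg (norm_nonneg _) hp.le]
  simp_rw [henorm]
  rw [← ofReal_integral_eq_lintegral_ofReal hint (Filter.Eventually.of_forall fun _ => by positivity),
    ← ENNReal.ofReal_mul (by positivity)]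
  refine ENNReal.ofReal_le_ofReal ?_
  rw [Real.circleAverage_def, intervalIntegral.integral_of_le hpi.le, smul_eq_mul] at h
  rwa [← le_div_iff₀ hpi, div_eq_inv_mul]

/-- The sub-mean value inequality for `|f|^p` over disks. -/
lemma enorm_rpow_mul_volume_le_lintegral_ball {f : ℂ → ℂ} {c : ℂ} {R p : ℝ} (hp : 0 < p)
    (hf : DifferentiableOn ℂ f (Metric.ball c R)) :
    ‖f c‖ₑ ^ p * volume (Metric.ball c R) ≤ ∫⁻ z in Metric.ball c R, ‖f z‖ₑ ^ p := by
  have hm : MeasurableSet (Metric.ball c R) := measurableSet_ball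
  -- Nothing is known about f off the ball; the extension by zero is Borel, as polar coordinates
  -- require.
  set g : ℂ → ℝ≥0∞ := (Metric.ball c R).indicator fun z => ‖f z‖ₑ ^ p with hgdef
  have hg : Measurable g := by
    have h1 : Measurable ((Metric.ball c R).indicator f) := by
      classical
      have := hf.continuousOn.measurable_piecewise (g := fun _ => (0 : ℂ)) continuousOn_const hm
      exact this
    have : g = (Metric.ball c R).indicator fun z => ‖(Metric.ball c R).indicator f z‖ₑ ^ p := by
      ext z
      by_cases hz : z ∈ Metric.ball c R <;> simp [hgdef, hz]
    rw [this]
    exact (h1.enorm.pow_const p).indicator hm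
  have e1 : ∫⁻ z in Metric.ball c R, ‖f z‖ₑ ^ p = ∫⁻ z, g (c + z) := by
    rw [lintegral_add_left_eq_self g c, lintegral_indicator hm]
  have e2 : ‖f c‖ₑ ^ p * volume (Metric.ball c R) =
      ∫⁻ z, (Metric.ball c R).indicator (fun _ => ‖f c‖ₑ ^ p) (c + z) := by
    rw [lintegral_add_left_eq_self ((Metric.ball c R).indicator (fun _ => ‖f c‖ₑ ^ p)) c,
      lintegral_indicator hm, setLIntegral_const]
  rw [e1, e2, lintegral_eq_lintegral_circleMap (F := fun z => g (c + z))
      (hg.comp (measurable_const_add c)),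
    lintegral_eq_lintegral_circleMap
      (F := fun z => (Metric.ball c R).indicator (fun _ => ‖f c‖ₑ ^ p) (c + z))
      ((measurable_const.indicator hm).comp (measurable_const_add c))]
  refine setLIntegral_mono' measurableSet_Ioi fun r hr => ?_
  have hr : 0 < r := hr
  gcongr ENNReal.ofReal r * ?_
  have hmap : ∀ θ, c + circleMap 0 r θ = circleMap c r θ := fun θ => by simp [circleMap]
  simp_rw [hmap]
  by_cases hrR : r < R
  · have hmem : ∀ θ, circleMap c r θ ∈ Metric.ball c R := fun θ => by
      simp [circleMap, abs_of_pos hr, hrR]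
    simp only [hgdef, indicator_of_mem (hmem _)]
    rw [setLIntegral_const, Real.volume_Ioc, sub_zero]
    refine enorm_rpow_mul_le_lintegral_circleMap hr hp ?_
    exact (hf.analyticOnNhd Metric.isOpen_ball).mono (Metric.closedBall_subset_ball hrR)
  · have hmem : ∀ θ, circleMap c r θ ∉ Metric.ball c R := fun θ => by
      simpa [circleMap, abs_of_pos hr] using not_lt.1 hrR
    simp [hmem]

/-! ### Pointwise growth in Bergman and Hardy spaces -/

lemma norm_lt_one_of_mem_disk {z : ℂ} (hz : z ∈ disk) : ‖z‖ < 1 := by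
  simpa [disk] using hz

lemma isOpen_disk : IsOpen disk := Metric.isOpen_ball

lemma measurableSet_disk : MeasurableSet disk := measurableSet_ball

lemma ball_half_subset_disk (w : ℂ) : Metric.ball w ((1 - ‖w‖) / 2) ⊆ disk := by
  intro z hz
  rw [mem_ball_iff_norm] at hz
  have h0 : 0 < 1 - ‖w‖ := by linarith [norm_nonneg (z - w)]
  have : ‖z‖ ≤ ‖z - w‖ + ‖w‖ := by simpa using norm_add_le (z - w) w
  simp only [disk, mem_ball_zero_iff]
  linarith

lemma eLpNorm_ofReal_rpow {X : Type*} [MeasurableSpace X] {μ : Measure X} {p : ℝ} (hp : 0 < p)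
    (f : X → ℂ) : eLpNorm f (ENNReal.ofReal p) μ ^ p = ∫⁻ x, ‖f x‖ₑ ^ p ∂μ := by
  rw [eLpNorm_eq_lintegral_rpow_enorm_toReal (by simpa using hp) (by simp),
    ENNReal.toReal_ofReal hp.le, ← ENNReal.rpow_mul, one_div_mul_cancel hp.ne', ENNReal.rpow_one]

/-- With R = (1-|w|)/2, every z in the ball has R ≤ 1-|z|² ≤ 6R. The lower bound serves α ≥ 0 and
the upper one α ≤ 0, whence the minimum of 1 and 6^α. -/
lemma smul_restrict_ball_le_dA {α : ℝ} (hα : -1 < α) (w : ℂ) :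
    ENNReal.ofReal ((1 + α) * (min 1 (6 ^ α) * ((1 - ‖w‖) / 2) ^ α) / Real.pi) •
      volume.restrict (Metric.ball w ((1 - ‖w‖) / 2)) ≤ dA α := by
  set R := (1 - ‖w‖) / 2 with hR
  have h1 : (dA α).restrict (Metric.ball w R) = (volume.restrict (Metric.ball w R)).withDensity
      fun z => ENNReal.ofReal ((1 + α) * (1 - ‖z‖ ^ 2) ^ α / Real.pi) := by
    rw [dA, restrict_withDensity measurableSet_ball, Measure.restrict_restrict measurableSet_ball,
      inter_eq_left.2 (ball_half_subset_disk w)]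
  refine le_trans ?_ (Measure.restrict_le_self (s := Metric.ball w R))
  rw [h1, ← withDensity_const]
  refine withDensity_mono ?_
  filter_upwards [ae_restrict_mem measurableSet_ball] with z hz
  rw [mem_ball_iff_norm] at hz
  have hR0 : 0 < R := by linarith [norm_nonneg (z - w)]
  have hz1 : ‖z‖ ≤ ‖z - w‖ + ‖w‖ := by simpa using norm_add_le (z - w) w
  have hz2 : ‖w‖ ≤ ‖z - w‖ + ‖z‖ := by
    rw [norm_sub_rev]; simpa using norm_add_le (w - z) z
  have hzl : R ≤ 1 - ‖z‖ ^ 2 := by nlinarith [norm_nonneg z]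
  have hzu : 1 - ‖z‖ ^ 2 ≤ 6 * R := by nlinarith [norm_nonneg z]
  refine ENNReal.ofReal_le_ofReal ?_
  have h0 : 0 < 1 + α := by linarith
  gcongr
  rcases le_total 0 α with h | h
  · calc min 1 (6 ^ α) * R ^ α ≤ 1 * R ^ α := by gcongr; exact min_le_left _ _
      _ = R ^ α := one_mul _
      _ ≤ _ := Real.rpow_le_rpow hR0.le hzl h
  · calc min 1 (6 ^ α) * R ^ α ≤ 6 ^ α * R ^ α := by gcongr; exact min_le_right _ _
      _ = (6 * R) ^ α := by rw [Real.mul_rpow (by norm_num) hR0.le]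
      _ ≤ _ := Real.rpow_le_rpow_of_nonpos (by linarith) hzu h

lemma enorm_rpow_le_of_bergman {p α : ℝ} (hp : 0 < p) (hα : -1 < α) {f : ℂ → ℂ}
    (hf : DifferentiableOn ℂ f disk) {w : ℂ} (hw : w ∈ disk) :
    ENNReal.ofReal ((1 + α) * min 1 (6 ^ α) * 2⁻¹ ^ (2 + α) * (1 - ‖w‖) ^ (2 + α)) * ‖f w‖ₑ ^ p ≤
      eLpNorm f (ENNReal.ofReal p) (dA α) ^ p := by
  have hw1 := norm_lt_one_of_mem_disk hw
  set R := (1 - ‖w‖) / 2 with hR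
  have hR0 : 0 < R := by linarith
  have h1 := enorm_rpow_mul_volume_le_lintegral_ball hp (hf.mono (ball_half_subset_disk w))
  have h2 := lintegral_mono' (smul_restrict_ball_le_dA hα w) (le_refl fun z => ‖f z‖ₑ ^ p)
  rw [lintegral_smul_measure, ← eLpNorm_ofReal_rpow (μ := dA α) hp, ← hR] at h2
  refine le_trans ?_ h2
  rw [← hR] at h1
  refine le_trans (le_of_eq ?_) (mul_le_mul_right h1 _)
  have h0 : 0 < 1 + α := by linarith
  rw [Complex.volume_ball, mul_comm (‖f w‖ₑ ^ p), ← mul_assoc]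
  congr 1
  have : ((NNReal.pi : NNReal) : ℝ≥0∞) = ENNReal.ofReal Real.pi := by
    rw [ENNReal.ofReal]; congr 1; ext; simp [Real.pi_nonneg]
  rw [this, ← ENNReal.ofReal_pow hR0.le, ← ENNReal.ofReal_mul (by positivity),
    ← ENNReal.ofReal_mul (by positivity)]
  congr 1
  have h3 : (2⁻¹ : ℝ) ^ (2 + α) * (1 - ‖w‖) ^ (2 + α) = R ^ α * R ^ 2 := by
    rw [← Real.mul_rpow (by norm_num) (by linarith), ← Real.rpow_natCast R 2,
      ← Real.rpow_add hR0]
    congr 1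
    · rw [hR]; ring
    · push_cast; ring
  rw [mul_assoc, h3]
  have := Real.pi_pos
  field_simp

lemma lintegral_circleMap_le_hardyNorm {p : ℝ} (hp : 0 < p) (f : ℂ → ℂ) {r : ℝ} (hr0 : 0 ≤ r)
    (hr1 : r < 1) :
    ∫⁻ θ in Ioc 0 (2 * Real.pi), ‖f (circleMap 0 r θ)‖ₑ ^ p ≤
      ENNReal.ofReal (2 * Real.pi) * hardyNorm p f ^ p := by
  have h1 : eLpNorm (fun θ : ℝ => f (circleMap 0 r θ)) (ENNReal.ofReal p) arcMeasure ≤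
      hardyNorm p f := by
    unfold hardyNorm
    exact le_iSup₂_of_le (f := fun (r : ℝ) (_ : r ∈ Ico (0 : ℝ) 1) =>
      eLpNorm (fun θ : ℝ => f (circleMap 0 r θ)) (ENNReal.ofReal p) arcMeasure) r ⟨hr0, hr1⟩ le_rfl
  have h2 := ENNReal.rpow_le_rpow h1 hp.le
  rw [eLpNorm_ofReal_rpow hp, arcMeasure, lintegral_smul_measure, smul_eq_mul] at h2
  rwa [ENNReal.inv_mul_le_iff (by simp [Real.pi_pos]) ENNReal.ofReal_ne_top] at h2

/-- The ball of radius R = (1-|w|)/2 about w lies in an annulus of width 2R, on each circle of which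
the mean of |f|^p is at most the p-th power of the Hardy norm. Its area πR² against 2R · 2π leaves
R/4 = (1-|w|)/8. No boundary values are needed. -/
lemma enorm_rpow_le_of_hardy {p : ℝ} (hp : 0 < p) {f : ℂ → ℂ}
    (hf : DifferentiableOn ℂ f disk) {w : ℂ} (hw : w ∈ disk) :
    ENNReal.ofReal (8⁻¹ * (1 - ‖w‖)) * ‖f w‖ₑ ^ p ≤ hardyNorm p f ^ p := by
  have hw1 := norm_lt_one_of_mem_disk hw
  set R := (1 - ‖w‖) / 2 with hR
  have hR0 : 0 < R := by linarith
  set A : Set ℝ := Ioo (‖w‖ - R) (‖w‖ + R) with hA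
  have h1 := enorm_rpow_mul_volume_le_lintegral_ball hp (hf.mono (ball_half_subset_disk w))
  rw [← hR] at h1
  have hm : MeasurableSet (Metric.ball w R) := measurableSet_ball
  set g : ℂ → ℝ≥0∞ := (Metric.ball w R).indicator fun z => ‖f z‖ₑ ^ p with hgdef
  have hg : Measurable g := by
    have h1 : Measurable ((Metric.ball w R).indicator f) := by
      classical
      have := (hf.mono (ball_half_subset_disk w)).continuousOn.measurable_piecewise
        (g := fun _ => (0 : ℂ)) continuousOn_const hm
      exact this
    have : g = (Metric.ball w R).indicator fun z => ‖(Metric.ball w R).indicator f z‖ₑ ^ p := by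
      ext z
      by_cases hz : z ∈ Metric.ball w R <;> simp [hgdef, hz]
    rw [this]
    exact (h1.enorm.pow_const p).indicator hm
  have h2 : ∫⁻ z in Metric.ball w R, ‖f z‖ₑ ^ p ≤
      ENNReal.ofReal (2 * R) * (ENNReal.ofReal (2 * Real.pi) * hardyNorm p f ^ p) := by
    rw [← lintegral_indicator hm, ← hgdef, lintegral_eq_lintegral_circleMap hg]
    calc ∫⁻ r in Ioi (0 : ℝ), ENNReal.ofReal r * ∫⁻ θ in Ioc 0 (2 * Real.pi), g (circleMap 0 r θ)
        ≤ ∫⁻ r in Ioi (0 : ℝ), A.indicator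
            (fun _ => ENNReal.ofReal (2 * Real.pi) * hardyNorm p f ^ p) r := by
          refine setLIntegral_mono' measurableSet_Ioi fun r hr => ?_
          have hr : 0 < r := hr
          by_cases hrA : r ∈ A
          · have hr1 : r < 1 := by linarith [hrA.2]
            rw [indicator_of_mem hrA]
            calc ENNReal.ofReal r * ∫⁻ θ in Ioc 0 (2 * Real.pi), g (circleMap 0 r θ)
                ≤ 1 * ∫⁻ θ in Ioc 0 (2 * Real.pi), ‖f (circleMap 0 r θ)‖ₑ ^ p := by
                  gcongr
                  · exact ENNReal.ofReal_le_one.2 hr1.le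
                  · exact indicator_le_self _ _ _
              _ ≤ _ := by
                  rw [one_mul]; exact lintegral_circleMap_le_hardyNorm hp f hr.le hr1
          · have : ∀ θ, circleMap 0 r θ ∉ Metric.ball w R := fun θ hθ => hrA (by
              rw [mem_ball_iff_norm] at hθ
              have hn : ‖circleMap 0 r θ‖ = r := by simp [abs_of_pos hr]
              have h3 := (abs_norm_sub_norm_le (circleMap 0 r θ) w).trans_lt hθ
              rw [hn, abs_lt] at h3
              exact ⟨by linarith, by linarith⟩)
            simp [hgdef, this]
      _ ≤ ∫⁻ r, A.indicator (fun _ => ENNReal.ofReal (2 * Real.pi) * hardyNorm p f ^ p) r :=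
          setLIntegral_le_lintegral _ _
      _ = _ := by
          rw [lintegral_indicator measurableSet_Ioo, setLIntegral_const, Real.volume_Ioo,
            mul_comm]
          congr 2; ring
  have h3 := h1.trans h2
  have hpi : ((NNReal.pi : NNReal) : ℝ≥0∞) = ENNReal.ofReal Real.pi := by
    rw [ENNReal.ofReal]; congr 1; ext; simp [Real.pi_nonneg]
  rw [Complex.volume_ball, hpi, ← ENNReal.ofReal_pow hR0.le,
    ← ENNReal.ofReal_mul (pow_nonneg hR0.le 2), ← mul_assoc,
    ← ENNReal.ofReal_mul (by positivity), mul_comm (‖f w‖ₑ ^ p)] at h3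
  calc ENNReal.ofReal (8⁻¹ * (1 - ‖w‖)) * ‖f w‖ₑ ^ p
      = ENNReal.ofReal (2 * R * (2 * Real.pi))⁻¹ *
          (ENNReal.ofReal (R ^ 2 * Real.pi) * ‖f w‖ₑ ^ p) := by
        rw [← mul_assoc, ← ENNReal.ofReal_mul (by positivity)]
        congr 2
        have := Real.pi_pos
        field_simp
        rw [hR]; ring
    _ ≤ ENNReal.ofReal (2 * R * (2 * Real.pi))⁻¹ *
          (ENNReal.ofReal (2 * R * (2 * Real.pi)) * hardyNorm p f ^ p) := mul_le_mul_right h3 _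
    _ = hardyNorm p f ^ p := by
        rw [← mul_assoc, ← ENNReal.ofReal_mul (by positivity), inv_mul_cancel₀ (by positivity),
          ENNReal.ofReal_one, one_mul]

/-- Growth estimate for functions in `A^p_α`. -/
lemma exists_norm_le_bergmanNorm {p α : ℝ} (hp : 0 < p) (hα : -1 ≤ α) :
    ∃ C > 0, ∀ (f : ℂ → ℂ) (N : ℝ), DifferentiableOn ℂ f disk → 0 ≤ N →
      bergmanNorm p α f ≤ ENNReal.ofReal N → ∀ w ∈ disk,
        ‖f w‖ ≤ C * N * (1 - ‖w‖) ^ (-((2 + α) / p)) := by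
  obtain ⟨c, hc, h⟩ : ∃ c > 0, ∀ (f : ℂ → ℂ), DifferentiableOn ℂ f disk → ∀ w ∈ disk,
      ENNReal.ofReal (c * (1 - ‖w‖) ^ (2 + α)) * ‖f w‖ₑ ^ p ≤ bergmanNorm p α f ^ p := by
    by_cases h : α = -1
    · refine ⟨8⁻¹, by norm_num, fun f hf w hw => ?_⟩
      have := enorm_rpow_le_of_hardy hp hf hw
      rw [bergmanNorm, if_pos h]
      rwa [h, show (2 + -1 : ℝ) = 1 by norm_num, Real.rpow_one]
    · have hα' : -1 < α := lt_of_le_of_ne hα (Ne.symm h)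
      have h0 : 0 < 1 + α := by linarith
      refine ⟨(1 + α) * min 1 (6 ^ α) * 2⁻¹ ^ (2 + α), by positivity, fun f hf w hw => ?_⟩
      rw [bergmanNorm, if_neg h]
      exact enorm_rpow_le_of_bergman hp hα' hf hw
  refine ⟨c⁻¹ ^ (1 / p), by positivity, fun f N hf hN hfN w hw => ?_⟩
  have hw1 : 0 < 1 - ‖w‖ := by linarith [norm_lt_one_of_mem_disk hw]
  have h1 := (h f hf w hw).trans (ENNReal.rpow_le_rpow hfN hp.le)
  rw [← ofReal_norm, ENNReal.ofReal_rpow_of_nonneg (norm_nonneg _) hp.le,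
    ENNReal.ofReal_rpow_of_nonneg hN hp.le, ← ENNReal.ofReal_mul (by positivity),
    ENNReal.ofReal_le_ofReal_iff (by positivity)] at h1
  have h2 : ‖f w‖ ^ p ≤ c⁻¹ * N ^ p * (1 - ‖w‖) ^ (-(2 + α)) := by
    rw [Real.rpow_neg hw1.le]
    have : 0 < (1 - ‖w‖) ^ (2 + α) := by positivity
    rw [← div_eq_mul_inv, le_div_iff₀ this, ← div_eq_inv_mul, le_div_iff₀ hc]
    linarith
  have h3 := Real.rpow_le_rpow (by positivity) h2 (by positivity : 0 ≤ 1 / p)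
  rw [← Real.rpow_mul (norm_nonneg _), mul_one_div_cancel hp.ne', Real.rpow_one,
    Real.mul_rpow (by positivity) (by positivity), Real.mul_rpow (by positivity) (by positivity),
    ← Real.rpow_mul hN, mul_one_div_cancel hp.ne', Real.rpow_one, ← Real.rpow_mul hw1.le] at h3
  convert h3 using 3
  ring

/-! ### Growth and local variation of derivatives -/

lemma analyticAt_of_mem_disk {f : ℂ → ℂ} (hf : DifferentiableOn ℂ f disk) {z : ℂ}
    (hz : z ∈ disk) : AnalyticAt ℂ f z :=
  hf.analyticAt (isOpen_disk.mem_nhds hz)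

lemma differentiableOn_iteratedDeriv {f : ℂ → ℂ} (hf : DifferentiableOn ℂ f disk) (k : ℕ) :
    DifferentiableOn ℂ (iteratedDeriv k f) disk := fun z hz => by
  rw [iteratedDeriv_eq_iterate]
  exact ((analyticAt_of_mem_disk hf hz).iterated_deriv k).differentiableAt.differentiableWithinAt

/-- Cauchy estimates for the derivatives of a holomorphic function of polynomial growth. -/
lemma norm_iteratedDeriv_le_of_growth {f : ℂ → ℂ} {A s : ℝ} (hA : 0 ≤ A) (hs : 0 ≤ s)
    (hf : DifferentiableOn ℂ f disk) (hfA : ∀ w ∈ disk, ‖f w‖ ≤ A * (1 - ‖w‖) ^ (-s)) (k : ℕ)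
    {w : ℂ} (hw : w ∈ disk) :
    ‖iteratedDeriv k f w‖ ≤ k.factorial * 2 ^ (s + k) * A * (1 - ‖w‖) ^ (-(s + k)) := by
  have hw1 := norm_lt_one_of_mem_disk hw
  set R := (1 - ‖w‖) / 2 with hR
  have hR0 : 0 < R := by linarith
  have hsub : Metric.closedBall w R ⊆ disk := by
    intro z hz
    rw [mem_closedBall_iff_norm] at hz
    have : ‖z‖ ≤ ‖z - w‖ + ‖w‖ := by simpa using norm_add_le (z - w) w
    simp only [disk, mem_ball_zero_iff]
    linarith
  have h1 := Complex.norm_iteratedDeriv_le_of_forall_mem_sphere_norm_le (f := f) (c := w)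
    (C := A * R ^ (-s)) k hR0 ((hf.mono hsub).diffContOnCl_ball subset_rfl) (fun z hz => by
      have hzd := hsub (Metric.sphere_subset_closedBall hz)
      rw [mem_sphere_iff_norm] at hz
      have : ‖z‖ ≤ ‖z - w‖ + ‖w‖ := by simpa using norm_add_le (z - w) w
      refine (hfA z hzd).trans ?_
      gcongr ?_ * ?_
      exact Real.rpow_le_rpow_of_nonpos hR0 (by linarith) (by linarith))
  refine h1.trans (le_of_eq ?_)
  have h2 : (1 - ‖w‖) ^ (-(s + k)) = (2 : ℝ) ^ (-(s + k)) * R ^ (-(s + k)) := by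
    rw [← Real.mul_rpow (by norm_num) hR0.le]; congr 1; rw [hR]; ring
  have h3 : R ^ (-(s + k)) = R ^ (-s) / R ^ k := by
    rw [neg_add, Real.rpow_add hR0, Real.rpow_neg hR0.le (k : ℝ), Real.rpow_natCast]; rfl
  have h4 : (2 : ℝ) ^ (s + k) * (2 : ℝ) ^ (-(s + k)) = 1 := by
    rw [← Real.rpow_add (by norm_num)]; simp
  rw [h2, h3]
  linear_combination (-(k.factorial * A * R ^ (-s) / R ^ k)) * h4

lemma one_sub_norm_sq_pos {w : ℂ} (hw : w ∈ disk) : 0 < 1 - ‖w‖ ^ 2 := by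
  have := norm_lt_one_of_mem_disk hw
  nlinarith [norm_nonneg w]

lemma one_sub_norm_sq_le {w : ℂ} (hw : w ∈ disk) : 1 - ‖w‖ ^ 2 ≤ 2 * (1 - ‖w‖) := by
  nlinarith [norm_lt_one_of_mem_disk hw, norm_nonneg w]

lemma one_sub_norm_rpow_neg_le {w : ℂ} (hw : w ∈ disk) {t : ℝ} (ht : 0 ≤ t) :
    (1 - ‖w‖) ^ (-t) ≤ 2 ^ t * (1 - ‖w‖ ^ 2) ^ (-t) := by
  have h0 := one_sub_norm_sq_pos hw
  have h1 := one_sub_norm_sq_le hw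
  have h2 : 0 < 1 - ‖w‖ := by linarith
  have h3 : (2:ℝ) ^ t * (2:ℝ) ^ (-t) = 1 := by
    rw [← Real.rpow_add (by norm_num)]; simp
  calc (1 - ‖w‖) ^ (-t) = 2 ^ t * (2 * (1 - ‖w‖)) ^ (-t) := by
        rw [Real.mul_rpow (by norm_num) h2.le, ← mul_assoc, h3, one_mul]
    _ ≤ _ := by
      gcongr ?_ * ?_
      exact Real.rpow_le_rpow_of_nonpos h0 h1 (by linarith)

lemma one_sub_norm_sq_rpow_mul_le {w : ℂ} (hw : w ∈ disk) {t : ℝ} (ht : 0 ≤ t) :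
    (1 - ‖w‖ ^ 2) ^ t * (1 - ‖w‖) ^ (-t) ≤ 2 ^ t := by
  have h0 := one_sub_norm_sq_pos hw
  calc (1 - ‖w‖ ^ 2) ^ t * (1 - ‖w‖) ^ (-t)
      ≤ (1 - ‖w‖ ^ 2) ^ t * (2 ^ t * (1 - ‖w‖ ^ 2) ^ (-t)) := by
        gcongr; exact one_sub_norm_rpow_neg_le hw ht
    _ = 2 ^ t * (1 - ‖w‖ ^ 2) ^ (t + -t) := by rw [Real.rpow_add h0]; ring
    _ = 2 ^ t := by simp

/-- Derivatives at hyperbolically close points are close. -/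
lemma norm_iteratedDeriv_sub_le_of_growth (s : ℝ) (hs : 0 ≤ s) (k : ℕ) :
    ∃ C > 0, ∀ (f : ℂ → ℂ) (A : ℝ), 0 ≤ A → DifferentiableOn ℂ f disk →
      (∀ w ∈ disk, ‖f w‖ ≤ A * (1 - ‖w‖) ^ (-s)) → ∀ a ∈ disk, ∀ w ∈ disk, ∀ τ ≤ (1 / 2 : ℝ),
        ‖w - a‖ ≤ τ * (1 - ‖a‖) →
        (1 - ‖w‖ ^ 2) ^ (s + k) * ‖iteratedDeriv k f w - iteratedDeriv k f a‖ ≤ C * A * τ := by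
  set t : ℝ := s + k with ht
  have ht0 : 0 ≤ t := by positivity
  set C0 : ℝ := (k + 1).factorial * 2 ^ (s + ((k + 1 : ℕ) : ℝ)) with hC0
  refine ⟨3 ^ t * (C0 * 2⁻¹ ^ (-(t + 1))), by positivity, fun f A hA hf hfA a ha w hw τ hτ hwa => ?_⟩
  have ha1 := norm_lt_one_of_mem_disk ha
  set d := 1 - ‖a‖ with hd
  have hd0 : 0 < d := by linarith
  have hball : ∀ z ∈ Metric.closedBall a (d / 2), d / 2 ≤ 1 - ‖z‖ := fun z hz => by
    rw [mem_closedBall_iff_norm] at hz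
    have : ‖z‖ ≤ ‖z - a‖ + ‖a‖ := by simpa using norm_add_le (z - a) a
    linarith
  have hbd : ∀ z ∈ Metric.closedBall a (d / 2), z ∈ disk := fun z hz => by
    have := hball z hz
    simp only [disk, mem_ball_zero_iff]; linarith
  have hwmem : w ∈ Metric.closedBall a (d / 2) := by
    rw [mem_closedBall_iff_norm]; nlinarith
  -- Mean value inequality: the derivative of order k+1 is O(d^{-(t+1)}) on this ball, the step is
  -- at most τd, and the weight is O(d^t), so the powers of d cancel and τ remains.
  have hderiv : ∀ z ∈ Metric.closedBall a (d / 2),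
      ‖deriv (iteratedDeriv k f) z‖ ≤ C0 * A * (d / 2) ^ (-(t + 1)) := fun z hz => by
    rw [← iteratedDeriv_succ]
    refine (norm_iteratedDeriv_le_of_growth hA hs hf hfA (k + 1) (hbd z hz)).trans ?_
    have e : s + ((k + 1 : ℕ) : ℝ) = t + 1 := by push_cast; ring
    rw [hC0, e]
    gcongr ?_ * ?_
    exact Real.rpow_le_rpow_of_nonpos (by linarith) (hball z hz) (by linarith)
  have h1 := (convex_closedBall a (d / 2)).norm_image_sub_le_of_norm_deriv_le
    (fun z hz => (differentiableOn_iteratedDeriv hf k).differentiableAt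
      (isOpen_disk.mem_nhds (hbd z hz))) hderiv
    (Metric.mem_closedBall_self (by linarith)) hwmem
  have h2 : 1 - ‖w‖ ^ 2 ≤ 3 * d := by
    have h3 : ‖a‖ ≤ ‖w - a‖ + ‖w‖ := by rw [norm_sub_rev]; simpa using norm_add_le (a - w) w
    have h4 := one_sub_norm_sq_le hw
    rw [mem_closedBall_iff_norm] at hwmem
    linarith
  calc (1 - ‖w‖ ^ 2) ^ t * ‖iteratedDeriv k f w - iteratedDeriv k f a‖
      ≤ (3 * d) ^ t * (C0 * A * (d / 2) ^ (-(t + 1)) * (τ * d)) := by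
        have := (one_sub_norm_sq_pos hw).le
        gcongr
        exact h1.trans (by gcongr)
    _ = 3 ^ t * (C0 * 2⁻¹ ^ (-(t + 1))) * A * τ * (d ^ t * d ^ (-(t + 1)) * d) := by
        rw [Real.mul_rpow (by norm_num) hd0.le, div_eq_mul_inv, Real.mul_rpow hd0.le (by norm_num)]
        ring
    _ = _ := by
        have : d ^ t * d ^ (-(t + 1)) * d = 1 := by
          rw [← Real.rpow_add hd0, show t + -(t + 1) = -1 by ring, Real.rpow_neg_one,
            inv_mul_cancel₀ hd0.ne']
        rw [this, mul_one]

/-- Growth estimate for the derivatives of functions in `A^p_α`. -/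
lemma exists_norm_iteratedDeriv_le_bergmanNorm {p α : ℝ} (hp : 0 < p) (hα : -1 ≤ α) (k : ℕ) :
    ∃ C > 0, ∀ (f : ℂ → ℂ) (N : ℝ), DifferentiableOn ℂ f disk → 0 ≤ N →
      bergmanNorm p α f ≤ ENNReal.ofReal N → ∀ w ∈ disk,
        ‖iteratedDeriv k f w‖ ≤ C * N * (1 - ‖w‖ ^ 2) ^ (-((2 + α) / p + k)) := by
  obtain ⟨C, hC, h⟩ := exists_norm_le_bergmanNorm hp hα
  have hs : 0 ≤ (2 + α) / p := div_nonneg (by linarith) hp.le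
  refine ⟨k.factorial * 2 ^ ((2 + α) / p + k) * C * 2 ^ ((2 + α) / p + k), by positivity,
    fun f N hf hN hfN w hw => ?_⟩
  refine (norm_iteratedDeriv_le_of_growth (by positivity) hs hf (h f N hf hN hfN) k hw).trans ?_
  calc _ ≤ k.factorial * 2 ^ ((2 + α) / p + k) * (C * N) *
        (2 ^ ((2 + α) / p + k) * (1 - ‖w‖ ^ 2) ^ (-((2 + α) / p + k))) := by
        gcongr
        exact one_sub_norm_rpow_neg_le hw (by positivity)
    _ = _ := by ring

/-! ### Sufficiency: majorants from the integral condition -/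

lemma aestronglyMeasurable_dA {E : Type*} [TopologicalSpace E]
    [TopologicalSpace.PseudoMetrizableSpace E] {g : ℂ → E} (hg : ContinuousOn g disk) (β : ℝ) :
    AEStronglyMeasurable g (dA β) :=
  (hg.aestronglyMeasurable_of_isSeparable measurableSet_disk
    (TopologicalSpace.IsSeparable.of_separableSpace disk)).mono_ac (withDensity_absolutelyContinuous _ _)

lemma ae_mem_disk (β : ℝ) : ∀ᵐ z ∂dA β, z ∈ disk :=
  (withDensity_absolutelyContinuous _ _).ae_le (ae_restrict_mem measurableSet_disk)

lemma differentiableOn_diffComp {k : ℕ} {u φ f : ℂ → ℂ} (hu : DifferentiableOn ℂ u disk)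
    (hφ : DifferentiableOn ℂ φ disk) (hφm : MapsTo φ disk disk) (hf : DifferentiableOn ℂ f disk) :
    DifferentiableOn ℂ (diffComp k u φ f) disk :=
  hu.mul ((differentiableOn_iteratedDeriv hf k).comp hφ hφm)

lemma orderBounded_diffComp {p q α β : ℝ} (hp : 0 < p) (hq : 0 < q) (hα : -1 ≤ α) (hβ : -1 < β)
    (k : ℕ) {u φ : ℂ → ℂ} (hu : DifferentiableOn ℂ u disk)
    (hφ : DifferentiableOn ℂ φ disk) (hφm : MapsTo φ disk disk)
    (h : ∫⁻ z, ENNReal.ofReal (‖u z‖ ^ q /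
          (1 - ‖φ z‖ ^ 2) ^ ((2 + α) * (q / p) + (k : ℝ) * q)) ∂(dA β) < ⊤) :
    OrderBounded p α q β (diffComp k u φ) := by
  obtain ⟨C, hC, hgrow⟩ := exists_norm_iteratedDeriv_le_bergmanNorm hp hα k
  set g : ℂ → ℝ := fun z => ‖u z‖ * (1 - ‖φ z‖ ^ 2) ^ (-((2 + α) / p + k)) with hg
  have hgcont : ContinuousOn g disk := by
    refine (hu.continuousOn.norm).mul ?_
    refine ContinuousOn.rpow_const ?_ fun z hz => Or.inl (one_sub_norm_sq_pos (hφm hz)).ne'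
    exact continuousOn_const.sub (hφ.continuousOn.norm.pow 2)
  have hq' : ENNReal.ofReal q ≠ 0 := by simpa using hq
  have hgmem : MemLp g (ENNReal.ofReal q) (dA β) := by
    refine ⟨aestronglyMeasurable_dA hgcont β, ?_⟩
    rw [eLpNorm_lt_top_iff_lintegral_rpow_enorm_lt_top hq' ENNReal.ofReal_ne_top,
      ENNReal.toReal_ofReal hq.le]
    refine lt_of_eq_of_lt (lintegral_congr_ae ?_) h
    filter_upwards [ae_mem_disk β] with z hz
    have h0 := one_sub_norm_sq_pos (hφm hz)
    rw [← ofReal_norm, ENNReal.ofReal_rpow_of_nonneg (norm_nonneg _) hq.le]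
    congr 1
    have : 0 ≤ g z := by positivity
    rw [Real.norm_of_nonneg this, hg]
    simp only
    rw [Real.mul_rpow (norm_nonneg _) (by positivity), ← Real.rpow_mul h0.le, div_eq_mul_inv (‖u z‖ ^ q),
      ← Real.rpow_neg h0.le]
    congr 2
    field_simp
  -- Used with N the norm of f for the mapping property, and with N = 1 for the common majorant.
  have hpt : ∀ (f : ℂ → ℂ) (N : ℝ), DifferentiableOn ℂ f disk → 0 ≤ N →
      bergmanNorm p α f ≤ ENNReal.ofReal N → ∀ z ∈ disk,
        ‖diffComp k u φ f z‖ ≤ C * N * g z := fun f N hf hN hfN z hz => by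
    rw [diffComp, norm_mul, hg]
    calc _ ≤ ‖u z‖ * (C * N * (1 - ‖φ z‖ ^ 2) ^ (-((2 + α) / p + k))) := by
          gcongr; exact hgrow f N hf hN hfN _ (hφm hz)
      _ = _ := by ring
  refine ⟨fun f hf => ⟨differentiableOn_diffComp hu hφ hφm hf.1, ?_⟩, fun z => C * g z,
    hgmem.const_mul C, fun f hf hf1 z hz => ?_⟩
  · rw [bergmanNorm, if_neg hβ.ne']
    refine ((hgmem.const_mul (C * (bergmanNorm p α f).toReal)).of_le
      (aestronglyMeasurable_dA (differentiableOn_diffComp hu hφ hφm hf.1).continuousOn β) ?_).2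
    filter_upwards [ae_mem_disk β] with z hz
    exact (hpt f _ hf.1 ENNReal.toReal_nonneg (ENNReal.ofReal_toReal hf.2.ne).ge z hz).trans
      (le_abs_self _)
  · have := hpt f 1 hf.1 zero_le_one (by simpa using hf1.le) z hz
    rwa [mul_one] at this

lemma OrderBounded.sumDiffComp {p q α β : ℝ} (hβ : -1 < β) {n : ℕ}
    {u φ : Fin (n + 1) → ℂ → ℂ}
    (h : ∀ k : Fin (n + 1), OrderBounded p α q β (diffComp k (u k) (φ k))) :
    OrderBounded p α q β (sumDiffComp n u φ) := by
  choose hmaps g hg hgle using h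
  refine ⟨fun f hf => ⟨?_, ?_⟩, fun z => ∑ k, g k z, memLp_finsetSum _ fun k _ => hg k,
    fun f hf hf1 z hz => ?_⟩
  · exact DifferentiableOn.fun_sum fun k _ => (hmaps k hf).1
  · rw [bergmanNorm, if_neg hβ.ne']
    have : MemLp (fun z => ∑ k : Fin (n + 1), diffComp k (u k) (φ k) f z) (ENNReal.ofReal q)
        (dA β) := by
      refine memLp_finsetSum _ fun k _ => ⟨aestronglyMeasurable_dA (hmaps k hf).1.continuousOn β, ?_⟩
      have := (hmaps k hf).2
      rwa [bergmanNorm, if_neg hβ.ne'] at this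
    exact this.2
  · exact (norm_sum_le _ _).trans (Finset.sum_le_sum fun k _ => hgle k f hf hf1 z hz)

/-! ### Möbius maps and normalized kernels -/

lemma dA_univ_lt_top {α : ℝ} (hα : -1 < α) : dA α univ < ∞ := by
  have hm : Measurable (disk.indicator fun z : ℂ =>
      ENNReal.ofReal ((1 + α) * (1 - ‖z‖ ^ 2) ^ α / Real.pi)) :=
    Measurable.indicator (by fun_prop) measurableSet_disk
  rw [dA, withDensity_apply _ MeasurableSet.univ, Measure.restrict_univ,
    ← lintegral_indicator measurableSet_disk, lintegral_eq_lintegral_circleMap hm]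
  have h0 : 0 < 1 + α := by linarith
  set K : ℝ := (1 + α) * max 1 (2 ^ α) / Real.pi with hK
  have hint : IntegrableOn (fun r : ℝ => (1 - r) ^ α) (Ioc 0 1) := by
    have := (intervalIntegral.intervalIntegrable_rpow' (a := 0) (b := 1) hα).comp_sub_left 1
    rw [sub_zero, sub_self] at this
    exact (intervalIntegrable_iff_integrableOn_Ioc_of_le zero_le_one).1 this.symm
  have hle : ∀ r ∈ Ioi (0 : ℝ), (ENNReal.ofReal r * ∫⁻ θ in Ioc 0 (2 * Real.pi),
      (disk.indicator fun z : ℂ => ENNReal.ofReal ((1 + α) * (1 - ‖z‖ ^ 2) ^ α / Real.pi))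
        (circleMap 0 r θ)) ≤ (Ioc (0 : ℝ) 1).indicator (fun r => ENNReal.ofReal (2 * Real.pi * K) *
          ENNReal.ofReal ((1 - r) ^ α)) r := by
    intro r hr
    have hr : 0 < r := hr
    have hn : ∀ θ, ‖circleMap 0 r θ‖ = r := fun θ => by simp [abs_of_pos hr]
    by_cases hr1 : r < 1
    · have hmem : ∀ θ, circleMap 0 r θ ∈ disk := fun θ => by simp [disk, abs_of_pos hr, hr1]
      rw [indicator_of_mem (show r ∈ Ioc (0 : ℝ) 1 from ⟨hr, hr1.le⟩)]
      simp only [indicator_of_mem (hmem _), hn]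
      have hr2 : 0 ≤ 1 - r := by linarith
      have hr3 : 0 ≤ 1 - r ^ 2 := by nlinarith
      rw [setLIntegral_const, Real.volume_Ioc, sub_zero, ← ENNReal.ofReal_mul (by positivity),
        ← ENNReal.ofReal_mul hr.le, ← ENNReal.ofReal_mul (by positivity)]
      refine ENNReal.ofReal_le_ofReal ?_
      have e : (1 - r ^ 2) ^ α = (1 - r) ^ α * (1 + r) ^ α := by
        rw [← Real.mul_rpow hr2 (by linarith)]; congr 1; ring
      have h1 : (1 + r) ^ α ≤ max 1 (2 ^ α) := by
        rcases le_total 0 α with h | h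
        · exact (Real.rpow_le_rpow (by linarith) (by linarith) h).trans (le_max_right _ _)
        · exact (Real.rpow_le_one_of_one_le_of_nonpos (by linarith) h).trans (le_max_left _ _)
      calc r * ((1 + α) * (1 - r ^ 2) ^ α / Real.pi * (2 * Real.pi))
          ≤ 1 * ((1 + α) * ((1 - r) ^ α * max 1 (2 ^ α)) / Real.pi * (2 * Real.pi)) := by
            rw [e]
            gcongr
        _ = _ := by rw [hK]; ring
    · have hmem : ∀ θ, circleMap 0 r θ ∉ disk := fun θ => by
        simpa [disk, abs_of_pos hr] using not_lt.1 hr1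
      simp [hmem]
  refine (setLIntegral_mono' measurableSet_Ioi hle).trans_lt ?_
  refine (setLIntegral_le_lintegral _ _).trans_lt ?_
  rw [lintegral_indicator measurableSet_Ioc, lintegral_const_mul' _ _ ENNReal.ofReal_ne_top]
  exact ENNReal.mul_lt_top ENNReal.ofReal_lt_top hint.lintegral_lt_top

/-- The disk automorphism `z ↦ (z - a) / (1 - conj a * z)`. -/
noncomputable def mobius (a z : ℂ) : ℂ := (z - a) / (1 - (starRingEnd ℂ) a * z)

/-- The normalized kernel `((1 - |a|²) / (1 - conj a * z)²)^s`. -/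
noncomputable def kern (s : ℝ) (a z : ℂ) : ℂ :=
  (((1 - ‖a‖ ^ 2) ^ s : ℝ) : ℂ) * (1 - (starRingEnd ℂ) a * z) ^ ((-(2 * s) : ℝ) : ℂ)

/-- This keeps the base of the complex power in `kern` off the branch cut, and the denominator of
`mobius` away from zero. -/
lemma re_one_sub_conj_mul_pos {a z : ℂ} (ha : a ∈ disk) (hz : z ∈ disk) :
    0 < (1 - (starRingEnd ℂ) a * z).re := by
  have ha1 := norm_lt_one_of_mem_disk ha
  have hz1 := norm_lt_one_of_mem_disk hz
  have h1 : ((starRingEnd ℂ) a * z).re ≤ ‖(starRingEnd ℂ) a * z‖ := Complex.re_le_norm _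
  rw [norm_mul, RCLike.norm_conj] at h1
  have : ‖a‖ * ‖z‖ < 1 := by nlinarith [norm_nonneg a, norm_nonneg z]
  rw [Complex.sub_re, Complex.one_re]
  linarith

lemma one_sub_conj_mul_ne_zero {a z : ℂ} (ha : a ∈ disk) (hz : z ∈ disk) :
    1 - (starRingEnd ℂ) a * z ≠ 0 := fun h => by
  have := re_one_sub_conj_mul_pos ha hz
  simp [h] at this

lemma one_sub_conj_mul_self (a : ℂ) : 1 - (starRingEnd ℂ) a * a = ((1 - ‖a‖ ^ 2 : ℝ) : ℂ) := by
  rw [Complex.conj_mul']; push_cast; rfl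

lemma norm_one_sub_conj_mul_sq (a z : ℂ) :
    ‖1 - (starRingEnd ℂ) a * z‖ ^ 2 = ‖z - a‖ ^ 2 + (1 - ‖a‖ ^ 2) * (1 - ‖z‖ ^ 2) := by
  simp only [← Complex.normSq_eq_norm_sq, Complex.normSq_apply]
  simp
  ring

lemma one_sub_norm_mobius_sq {a z : ℂ} (ha : a ∈ disk) (hz : z ∈ disk) :
    1 - ‖mobius a z‖ ^ 2 =
      (1 - ‖a‖ ^ 2) / ‖1 - (starRingEnd ℂ) a * z‖ ^ 2 * (1 - ‖z‖ ^ 2) := by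
  have h0 : ‖1 - (starRingEnd ℂ) a * z‖ ≠ 0 := norm_ne_zero_iff.2 (one_sub_conj_mul_ne_zero ha hz)
  have h1 := norm_one_sub_conj_mul_sq a z
  rw [mobius, norm_div, div_pow]
  generalize ‖1 - (starRingEnd ℂ) a * z‖ = D at h0 h1 ⊢
  field_simp
  linarith

lemma mobius_mem_disk {a z : ℂ} (ha : a ∈ disk) (hz : z ∈ disk) : mobius a z ∈ disk := by
  have h0 : 0 < ‖1 - (starRingEnd ℂ) a * z‖ := norm_pos_iff.2 (one_sub_conj_mul_ne_zero ha hz)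
  have h1 := one_sub_norm_mobius_sq ha hz
  have h2 := one_sub_norm_sq_pos ha
  have h3 := one_sub_norm_sq_pos hz
  have h4 : 0 < 1 - ‖mobius a z‖ ^ 2 := by rw [h1]; positivity
  simp only [disk, mem_ball_zero_iff]
  nlinarith [norm_nonneg (mobius a z)]

lemma mobius_neg_mobius {a z : ℂ} (ha : a ∈ disk) (hz : z ∈ disk) :
    mobius (-a) (mobius a z) = z := by
  have h0 := one_sub_conj_mul_ne_zero ha hz
  have h1 := one_sub_conj_mul_ne_zero ha ha
  have h2 : 1 - (starRingEnd ℂ) (-a) * mobius a z =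
      (1 - (starRingEnd ℂ) a * a) / (1 - (starRingEnd ℂ) a * z) := by
    rw [mobius, map_neg, eq_div_iff h0, neg_mul, sub_neg_eq_add, add_mul, mul_assoc,
      div_mul_cancel₀ _ h0]; ring
  have h3 : mobius a z - -a = z * (1 - (starRingEnd ℂ) a * a) / (1 - (starRingEnd ℂ) a * z) := by
    rw [mobius, eq_div_iff h0, sub_neg_eq_add, add_mul, div_mul_cancel₀ _ h0]; ring
  rw [mobius, h2, h3, div_div_div_cancel_right₀ h0, mul_div_cancel_right₀ _ h1]

lemma neg_mem_disk {a : ℂ} (ha : a ∈ disk) : -a ∈ disk := by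
  simpa [disk] using ha

lemma injOn_mobius {a : ℂ} (ha : a ∈ disk) : InjOn (mobius a) disk := fun x hx y hy h => by
  rw [← mobius_neg_mobius ha hx, h, mobius_neg_mobius ha hy]

lemma mobius_image_disk {a : ℂ} (ha : a ∈ disk) : mobius a '' disk = disk := by
  refine subset_antisymm (image_subset_iff.2 fun z hz => mobius_mem_disk ha hz) fun z hz =>
    ⟨mobius (-a) z, mobius_mem_disk (neg_mem_disk ha) hz, ?_⟩
  have := mobius_neg_mobius (neg_mem_disk ha) hz
  rwa [neg_neg] at this

lemma hasDerivAt_mobius {a z : ℂ} (ha : a ∈ disk) (hz : z ∈ disk) :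
    HasDerivAt (mobius a)
      ((1 - (starRingEnd ℂ) a * a) / (1 - (starRingEnd ℂ) a * z) ^ 2) z := by
  have h0 := one_sub_conj_mul_ne_zero ha hz
  have h1 : HasDerivAt (fun z => z - a) 1 z := (hasDerivAt_id z).sub_const a
  have h2 : HasDerivAt (fun z => 1 - (starRingEnd ℂ) a * z) (-(starRingEnd ℂ) a) z := by
    simpa using ((hasDerivAt_id z).const_mul ((starRingEnd ℂ) a)).const_sub 1
  refine (h1.div h2 h0).congr_deriv ?_
  congr 1
  ring

lemma differentiableOn_mobius {a : ℂ} (ha : a ∈ disk) : DifferentiableOn ℂ (mobius a) disk :=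
  fun _ hz => (hasDerivAt_mobius ha hz).differentiableAt.differentiableWithinAt

lemma differentiableOn_kern (s : ℝ) {a : ℂ} (ha : a ∈ disk) :
    DifferentiableOn ℂ (kern s a) disk := fun z hz => by
  refine DifferentiableAt.differentiableWithinAt ?_
  refine DifferentiableAt.const_mul ?_ _
  refine DifferentiableAt.cpow (by fun_prop) (by fun_prop) (Or.inl (re_one_sub_conj_mul_pos ha hz))

lemma norm_kern (s : ℝ) {a z : ℂ} (ha : a ∈ disk) :
    ‖kern s a z‖ = ((1 - ‖a‖ ^ 2) / ‖1 - (starRingEnd ℂ) a * z‖ ^ 2) ^ s := by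
  have h1 := (one_sub_norm_sq_pos ha).le
  rw [kern, norm_mul, Complex.norm_cpow_real, Complex.norm_real,
    Real.norm_of_nonneg (by positivity), Real.div_rpow h1 (by positivity), div_eq_mul_inv,
    Real.rpow_neg (norm_nonneg _), Real.rpow_mul (norm_nonneg _)]
  norm_num

lemma kern_self (s : ℝ) {a : ℂ} (ha : a ∈ disk) :
    kern s a a = (((1 - ‖a‖ ^ 2) ^ (-s) : ℝ) : ℂ) := by
  have h1 := one_sub_norm_sq_pos ha
  rw [kern, one_sub_conj_mul_self, ← Complex.ofReal_cpow h1.le, ← Complex.ofReal_mul,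
    ← Real.rpow_add h1]
  congr 2; ring

/-- Möbius invariance of the weighted area. -/
lemma lintegral_mobius_jacobian {α : ℝ} {a : ℂ} (ha : a ∈ disk) :
    ∫⁻ z, ENNReal.ofReal (((1 - ‖a‖ ^ 2) / ‖1 - (starRingEnd ℂ) a * z‖ ^ 2) ^ (2 + α)) ∂dA α =
      dA α univ := by
  have hm : Measurable fun z : ℂ => ENNReal.ofReal ((1 + α) * (1 - ‖z‖ ^ 2) ^ α / Real.pi) := by
    fun_prop
  rw [dA, withDensity_apply _ MeasurableSet.univ, Measure.restrict_univ,
    lintegral_withDensity_eq_lintegral_mul _ hm (by fun_prop)]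
  -- Change of variables by `mobius a`: with J = |(`mobius a`)'|, the real Jacobian gives J² and the
  -- weight gives J^α.
  conv_rhs => rw [← mobius_image_disk ha]
  rw [lintegral_image_eq_lintegral_abs_det_fderiv_mul volume measurableSet_disk
    (fun z hz => ((hasDerivAt_mobius ha hz).hasFDerivAt.restrictScalars ℝ).hasFDerivWithinAt)
    (injOn_mobius ha)]
  refine setLIntegral_congr_fun measurableSet_disk fun z hz => ?_
  have h0 : 0 < ‖1 - (starRingEnd ℂ) a * z‖ := norm_pos_iff.2 (one_sub_conj_mul_ne_zero ha hz)
  have h2 := one_sub_norm_sq_pos ha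
  have h3 := one_sub_norm_sq_pos hz
  set J := (1 - ‖a‖ ^ 2) / ‖1 - (starRingEnd ℂ) a * z‖ ^ 2 with hJ
  have hJ0 : 0 < J := by positivity
  have hdet : |((ContinuousLinearMap.toSpanSingleton ℂ ((1 - (starRingEnd ℂ) a * a) /
      (1 - (starRingEnd ℂ) a * z) ^ 2)).restrictScalars ℝ).det| = J ^ 2 := by
    have : ((ContinuousLinearMap.toSpanSingleton ℂ ((1 - (starRingEnd ℂ) a * a) /
      (1 - (starRingEnd ℂ) a * z) ^ 2)).restrictScalars ℝ).det = ‖(1 - (starRingEnd ℂ) a * a) /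
      (1 - (starRingEnd ℂ) a * z) ^ 2‖ ^ 2 := by
      simp [ContinuousLinearMap.det, LinearMap.det_restrictScalars,
        Algebra.norm_complex_eq, Complex.normSq_eq_norm_sq, div_pow]
    rw [this, abs_of_nonneg (by positivity), norm_div, norm_pow, one_sub_conj_mul_self,
      Complex.norm_real, Real.norm_of_nonneg h2.le]
  simp only [Pi.mul_apply]
  rw [hdet, one_sub_norm_mobius_sq ha hz, ← hJ, mul_comm,
    ← ENNReal.ofReal_mul (by positivity), ← ENNReal.ofReal_mul (by positivity),
    Real.mul_rpow hJ0.le h3.le, Real.rpow_add hJ0, Real.rpow_two]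
  congr 1
  ring

/-- Since |1 - ā r e^{iθ}| = |e^{iθ} - ra| and 1-|a|² ≤ 1-|ra|², the integrand is at most the
Poisson kernel at ra, whose mean is 1. -/
lemma lintegral_circleMap_poisson_le {a : ℂ} (ha : a ∈ disk) {r : ℝ} (hr0 : 0 ≤ r) (hr1 : r < 1) :
    ∫⁻ θ in Ioc 0 (2 * Real.pi),
      ENNReal.ofReal ((1 - ‖a‖ ^ 2) / ‖1 - (starRingEnd ℂ) a * circleMap 0 r θ‖ ^ 2) ≤
      ENNReal.ofReal (2 * Real.pi) := by
  have ha1 := norm_lt_one_of_mem_disk ha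
  have hpi : (0 : ℝ) < 2 * Real.pi := by positivity
  have hra : ‖(r : ℂ) * a‖ = r * ‖a‖ := by simp [abs_of_nonneg hr0]
  have hra1 : r * ‖a‖ < 1 := by nlinarith [norm_nonneg a]
  set P : ℝ → ℝ := fun θ => (1 - (r * ‖a‖) ^ 2) / ‖circleMap 0 1 θ - r * a‖ ^ 2 with hP
  have hne : ∀ θ, ‖circleMap 0 1 θ - r * a‖ ≠ 0 := fun θ h => by
    rw [norm_eq_zero, sub_eq_zero] at h
    have := congrArg norm h
    rw [hra] at this
    simp at this
    linarith
  have hcont : Continuous P := by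
    refine continuous_const.div ?_ fun θ => pow_ne_zero 2 (hne θ)
    exact (((continuous_circleMap 0 1).sub continuous_const).norm).pow 2
  have h1 := DiffContOnCl.circleAverage_poissonKernel_smul' (c := 0) (R := 1) (w := (r : ℂ) * a)
    (f := fun _ => (1 : ℂ)) diffContOnCl_const (by rw [mem_ball_zero_iff, hra]; exact hra1)
  have h2 : ∫ θ in (0 : ℝ)..2 * Real.pi, P θ = 2 * Real.pi := by
    rw [Real.circleAverage_def] at h1
    simp only [sub_zero, hra, norm_circleMap_zero, abs_one, one_pow] at h1
    rw [intervalIntegral.integral_smul_const, ← smul_assoc] at h1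
    have h3 : (2 * Real.pi)⁻¹ * ∫ θ in (0 : ℝ)..2 * Real.pi, P θ = 1 := by
      have := congrArg Complex.re h1
      simpa using this
    field_simp at h3
    linarith
  rw [intervalIntegral.integral_of_le hpi.le] at h2
  have hP0 : ∀ θ, 0 ≤ P θ := fun θ => by
    have : 0 ≤ 1 - (r * ‖a‖) ^ 2 := by nlinarith [mul_nonneg hr0 (norm_nonneg a)]
    positivity
  have h6 := ofReal_integral_eq_lintegral_ofReal
    (μ := volume.restrict (Ioc 0 (2 * Real.pi)))
    (hcont.integrableOn_Icc.mono_set Ioc_subset_Icc_self) (Filter.Eventually.of_forall hP0)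
  rw [h2] at h6
  rw [h6]
  refine lintegral_mono fun θ => ENNReal.ofReal_le_ofReal ?_
  have hnorm : ‖1 - (starRingEnd ℂ) a * circleMap 0 r θ‖ = ‖circleMap 0 1 θ - r * a‖ := by
    have e : circleMap 0 1 θ * (starRingEnd ℂ) (1 - (starRingEnd ℂ) a * circleMap 0 r θ) =
        circleMap 0 1 θ - r * a := by
      have h4 : circleMap 0 1 θ * (starRingEnd ℂ) (circleMap 0 1 θ) = 1 := by
        rw [Complex.mul_conj']; simp
      have h5 : circleMap 0 r θ = r * circleMap 0 1 θ := by simp [circleMap]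
      rw [h5]
      simp only [map_sub, map_one, map_mul, Complex.conj_conj, Complex.conj_ofReal]
      linear_combination (-(a * r)) * h4
    rw [← e, norm_mul, RCLike.norm_conj]
    simp
  rw [hP, hnorm]
  simp only
  gcongr
  nlinarith [norm_nonneg a, mul_nonneg hr0 (norm_nonneg a)]

/-- Bounded multiples of the normalized kernels are bounded in `A^p_α`. -/
lemma exists_bergmanNorm_kern_mul_le {p α : ℝ} (hp : 0 < p) (hα : -1 ≤ α) :
    ∃ C > 0, ∀ a ∈ disk, ∀ (H : ℂ → ℂ) (M : ℝ), 0 ≤ M → (∀ z ∈ disk, ‖H z‖ ≤ M) →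
      bergmanNorm p α (fun z => kern ((2 + α) / p) a z * H z) ≤ ENNReal.ofReal (C * M) := by
  -- The exponent s = (2+α)/p turns |`kern`|^p into the power 2+α of the Möbius Jacobian factor: the
  -- Poisson bound applies when α = -1, Möbius invariance otherwise.
  have hpt : ∀ a ∈ disk, ∀ (H : ℂ → ℂ) (M : ℝ), 0 ≤ M → (∀ z ∈ disk, ‖H z‖ ≤ M) → ∀ z ∈ disk,
      ‖kern ((2 + α) / p) a z * H z‖ₑ ^ p ≤ ENNReal.ofReal (M ^ p) * ENNReal.ofReal
        (((1 - ‖a‖ ^ 2) / ‖1 - (starRingEnd ℂ) a * z‖ ^ 2) ^ (2 + α)) := by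
    intro a ha H M hM hH z hz
    have h2 := one_sub_norm_sq_pos ha
    rw [← ofReal_norm, ENNReal.ofReal_rpow_of_nonneg (norm_nonneg _) hp.le,
      ← ENNReal.ofReal_mul (by positivity)]
    refine ENNReal.ofReal_le_ofReal ?_
    rw [norm_mul, norm_kern _ ha, Real.mul_rpow (by positivity) (norm_nonneg _),
      ← Real.rpow_mul (by positivity), div_mul_cancel₀ _ hp.ne', mul_comm]
    gcongr
    exact hH z hz
  by_cases h : α = -1
  · refine ⟨1, one_pos, fun a ha H M hM hH => ?_⟩
    rw [bergmanNorm, if_pos h, hardyNorm, one_mul]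
    refine iSup₂_le fun r hr => ?_
    rw [← ENNReal.rpow_le_rpow_iff hp, eLpNorm_ofReal_rpow hp, arcMeasure,
      lintegral_smul_measure, smul_eq_mul, ENNReal.inv_mul_le_iff (by simp [Real.pi_pos])
      ENNReal.ofReal_ne_top, ENNReal.ofReal_rpow_of_nonneg hM hp.le]
    calc _ ≤ ∫⁻ θ in Ioc 0 (2 * Real.pi), ENNReal.ofReal (M ^ p) * ENNReal.ofReal
            ((1 - ‖a‖ ^ 2) / ‖1 - (starRingEnd ℂ) a * circleMap 0 r θ‖ ^ 2) := by
          refine lintegral_mono fun θ => ?_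
          have hz : circleMap 0 r θ ∈ disk := by simp [disk, abs_of_nonneg hr.1, hr.2]
          have := hpt a ha H M hM hH _ hz
          have e : 2 + α = 1 := by rw [h]; norm_num
          rw [e, Real.rpow_one] at this
          rwa [e]
      _ ≤ _ := by
          rw [lintegral_const_mul' _ _ ENNReal.ofReal_ne_top, mul_comm]
          gcongr
          exact lintegral_circleMap_poisson_le ha hr.1 hr.2
  · have hα' : -1 < α := lt_of_le_of_ne hα (Ne.symm h)
    have hfin := dA_univ_lt_top hα'
    refine ⟨(dA α univ).toReal ^ (1 / p) + 1, by positivity, fun a ha H M hM hH => ?_⟩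
    rw [bergmanNorm, if_neg h]
    have h1 : eLpNorm (fun z => kern ((2 + α) / p) a z * H z) (ENNReal.ofReal p) (dA α) ≤
        ENNReal.ofReal ((dA α univ).toReal ^ (1 / p) * M) := by
      rw [← ENNReal.rpow_le_rpow_iff hp, eLpNorm_ofReal_rpow hp,
        ENNReal.ofReal_rpow_of_nonneg (by positivity) hp.le,
        Real.mul_rpow (by positivity) hM, ← Real.rpow_mul ENNReal.toReal_nonneg,
        one_div_mul_cancel hp.ne', Real.rpow_one, ENNReal.ofReal_mul ENNReal.toReal_nonneg,
        ENNReal.ofReal_toReal hfin.ne]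
      calc _ ≤ ∫⁻ z, ENNReal.ofReal (M ^ p) * ENNReal.ofReal
              (((1 - ‖a‖ ^ 2) / ‖1 - (starRingEnd ℂ) a * z‖ ^ 2) ^ (2 + α)) ∂dA α := by
            refine lintegral_mono_ae ?_
            filter_upwards [ae_mem_disk α] with z hz using hpt a ha H M hM hH z hz
        _ = _ := by
            rw [lintegral_const_mul' _ _ ENNReal.ofReal_ne_top, lintegral_mobius_jacobian ha,
              mul_comm]
    refine h1.trans (ENNReal.ofReal_le_ofReal ?_)
    nlinarith

/-! ### Prescribed jets at one point -/

lemma iteratedDeriv_sub_pow_mul {g : ℂ → ℂ} {a : ℂ} (hg : AnalyticAt ℂ g a) (k : ℕ) {i : ℕ}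
    (hi : i ≤ k) : iteratedDeriv i (fun z => (z - a) ^ k * g z) a =
      if i = k then (k.factorial : ℂ) * g a else 0 := by
  have hpow : ∀ j, iteratedDeriv j (fun z : ℂ => (z - a) ^ k) a =
      if j = k then (k.factorial : ℂ) else 0 := fun j => by
    have := congrFun (iteratedDeriv_comp_sub_const j (fun z : ℂ => z ^ k) a) a
    rw [this, sub_self, iteratedDeriv_fun_pow_zero]
    split_ifs <;> simp
  have hA : AnalyticAt ℂ (fun z : ℂ => (z - a) ^ k) a := by fun_prop
  rw [iteratedDeriv_fun_mul hA.contDiffAt hg.contDiffAt]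
  simp_rw [hpow]
  split_ifs with h
  · subst h
    rw [Finset.sum_eq_single i]
    · simp
    · intro b _ hb; simp [hb]
    · intro h; simp at h
  · refine Finset.sum_eq_zero fun j hj => ?_
    have : j ≠ k := by have := Finset.mem_range.1 hj; omega
    simp [this]

/-- Both 1-|a| and 1-|w| are at most |1 - āw|. The bound is uniform in a, so the derivative
estimates apply to all kernels with the same constants. -/
lemma norm_kern_le {s : ℝ} (hs : 0 ≤ s) {a w : ℂ} (ha : a ∈ disk) (hw : w ∈ disk) :
    ‖kern s a w‖ ≤ 2 ^ s * (1 - ‖w‖) ^ (-s) := by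
  have ha1 := norm_lt_one_of_mem_disk ha
  have hw1 := norm_lt_one_of_mem_disk hw
  have h0 := one_sub_norm_sq_le ha
  have hpos := one_sub_norm_sq_pos ha
  have h1 : 1 - ‖a‖ * ‖w‖ ≤ ‖1 - (starRingEnd ℂ) a * w‖ := by
    have := norm_sub_norm_le 1 ((starRingEnd ℂ) a * w)
    rwa [norm_one, norm_mul, RCLike.norm_conj] at this
  have h2 : 1 - ‖a‖ ≤ 1 - ‖a‖ * ‖w‖ := by nlinarith [norm_nonneg a]
  have h3 : 1 - ‖w‖ ≤ 1 - ‖a‖ * ‖w‖ := by nlinarith [norm_nonneg w]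
  have hw2 : 0 < 1 - ‖w‖ := by linarith
  have hD : 0 < ‖1 - (starRingEnd ℂ) a * w‖ := by linarith
  rw [norm_kern s ha, Real.rpow_neg hw2.le, ← div_eq_mul_inv, ← Real.div_rpow (by norm_num) hw2.le]
  refine Real.rpow_le_rpow (by positivity) ?_ hs
  rw [div_le_div_iff₀ (by positivity) hw2]
  nlinarith [mul_le_mul (h2.trans h1) (h3.trans h1) hw2.le hD.le]

lemma norm_kern_mul_le {s : ℝ} (hs : 0 ≤ s) {a : ℂ} (ha : a ∈ disk) {H : ℂ → ℂ} {M : ℝ}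
    (hH : ∀ z ∈ disk, ‖H z‖ ≤ M) {w : ℂ} (hw : w ∈ disk) :
    ‖kern s a w * H w‖ ≤ 2 ^ s * M * (1 - ‖w‖) ^ (-s) := by
  have hw1 := norm_lt_one_of_mem_disk hw
  rw [norm_mul]
  calc ‖kern s a w‖ * ‖H w‖ ≤ (2 ^ s * (1 - ‖w‖) ^ (-s)) * M := by
        have h0 : 0 ≤ 1 - ‖w‖ := by linarith
        gcongr
        · exact norm_kern_le hs ha hw
        · exact hH w hw
    _ = _ := by ring

lemma exists_norm_iteratedDeriv_kern_mul_le {s : ℝ} (hs : 0 ≤ s) (k : ℕ) :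
    ∃ C > 0, ∀ a ∈ disk, ∀ (H : ℂ → ℂ) (M : ℝ), DifferentiableOn ℂ H disk → 0 ≤ M →
      (∀ z ∈ disk, ‖H z‖ ≤ M) → ∀ w ∈ disk,
        (1 - ‖w‖ ^ 2) ^ (s + k) * ‖iteratedDeriv k (fun z => kern s a z * H z) w‖ ≤ C * M := by
  refine ⟨k.factorial * 2 ^ (s + k) * 2 ^ s * 2 ^ (s + k), by positivity,
    fun a ha H M hH hM hHM w hw => ?_⟩
  have h1 := norm_iteratedDeriv_le_of_growth (f := fun z => kern s a z * H z) (A := 2 ^ s * M)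
    (by positivity) hs ((differentiableOn_kern s ha).mul hH)
    (fun w hw => norm_kern_mul_le hs ha hHM hw) k hw
  have h0 := one_sub_norm_sq_pos hw
  calc _ ≤ (1 - ‖w‖ ^ 2) ^ (s + k) *
        (k.factorial * 2 ^ (s + k) * (2 ^ s * M) * (1 - ‖w‖) ^ (-(s + k))) := by gcongr
    _ = k.factorial * 2 ^ (s + k) * (2 ^ s * M) *
        ((1 - ‖w‖ ^ 2) ^ (s + k) * (1 - ‖w‖) ^ (-(s + k))) := by ring
    _ ≤ k.factorial * 2 ^ (s + k) * (2 ^ s * M) * 2 ^ (s + k) := by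
        gcongr
        exact one_sub_norm_sq_rpow_mul_le hw (by positivity)
    _ = _ := by ring

/-- The k-th power of `mobius a` vanishes to order k at a and is bounded by 1. At a, the kernel
equals (1-|a|²)^{-s} and the Möbius derivative (1-|a|²)^{-1}, so dividing by k! B(a) normalizes the
k-th derivative. -/
lemma exists_lowest_order_jet (s : ℝ) {δ : ℝ} (hδ : 0 < δ) (k : ℕ) {a : ℂ} (ha : a ∈ disk)
    {B : ℂ → ℂ} (hB : DifferentiableOn ℂ B disk) (hBa : δ ≤ ‖B a‖) :
    ∃ G : ℂ → ℂ, DifferentiableOn ℂ G disk ∧ (∀ z ∈ disk, ‖G z‖ ≤ 1 / δ) ∧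
      (∀ i < k, iteratedDeriv i (fun z => kern s a z * (B z * G z)) a = 0) ∧
      (((1 - ‖a‖ ^ 2) ^ (s + k) : ℝ) : ℂ) *
        iteratedDeriv k (fun z => kern s a z * (B z * G z)) a = 1 := by
  have hBa0 : B a ≠ 0 := norm_pos_iff.1 (hδ.trans_le hBa)
  have hpos := one_sub_norm_sq_pos ha
  have hfac : ((k.factorial : ℕ) : ℂ) ≠ 0 := by exact_mod_cast k.factorial_ne_zero
  refine ⟨fun z => mobius a z ^ k / (k.factorial * B a),
    ((differentiableOn_mobius ha).pow k).div_const _, fun z hz => ?_, ?_⟩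
  · rw [norm_div, norm_pow, norm_mul]
    have h1 := norm_lt_one_of_mem_disk (mobius_mem_disk ha hz)
    have h2 : (1 : ℝ) ≤ ‖((k.factorial : ℕ) : ℂ)‖ := by
      rw [Complex.norm_natCast]; exact_mod_cast Nat.one_le_iff_ne_zero.2 k.factorial_ne_zero
    have h3 : δ ≤ ‖((k.factorial : ℕ) : ℂ)‖ * ‖B a‖ := by nlinarith
    exact div_le_div₀ zero_le_one (pow_le_one₀ (norm_nonneg _) h1.le) hδ h3
  · set g : ℂ → ℂ := fun z =>
      kern s a z * B z / ((1 - (starRingEnd ℂ) a * z) ^ k * (k.factorial * B a)) with hg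
    have hgd : DifferentiableOn ℂ g disk := by
      refine ((differentiableOn_kern s ha).mul hB).div (by fun_prop) fun z hz => ?_
      exact mul_ne_zero (pow_ne_zero _ (one_sub_conj_mul_ne_zero ha hz)) (mul_ne_zero hfac hBa0)
    have e : (fun z => kern s a z * (B z * (mobius a z ^ k / (k.factorial * B a)))) =
        fun z => (z - a) ^ k * g z := by
      ext z
      rw [hg, mobius, div_pow]
      ring
    have hga : AnalyticAt ℂ g a := analyticAt_of_mem_disk hgd ha
    rw [e]
    refine ⟨fun i hi => ?_, ?_⟩
    · rw [iteratedDeriv_sub_pow_mul hga k hi.le, if_neg hi.ne]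
    · rw [iteratedDeriv_sub_pow_mul hga k le_rfl, if_pos rfl, hg]
      simp only
      rw [kern_self s ha, one_sub_conj_mul_self]
      have h1 : ((1 - ‖a‖ ^ 2 : ℝ) : ℂ) ^ k ≠ 0 := pow_ne_zero _ (by exact_mod_cast hpos.ne')
      have h2 : (((1 - ‖a‖ ^ 2) ^ (s + k) : ℝ) : ℂ) * (((1 - ‖a‖ ^ 2) ^ (-s) : ℝ) : ℂ) =
          ((1 - ‖a‖ ^ 2 : ℝ) : ℂ) ^ k := by
        rw [← Complex.ofReal_mul, ← Real.rpow_add hpos, add_neg_cancel_comm, Real.rpow_natCast,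
          Complex.ofReal_pow]
      field_simp
      exact h2

/-- Prescribing jets: one normalized derivative at `a` equals `1`, the others vanish. -/
lemma exists_jet {s : ℝ} (hs : 0 ≤ s) {δ : ℝ} (hδ : 0 < δ) (k m : ℕ) :
    ∃ C > 0, ∀ a ∈ disk, ∀ B : ℂ → ℂ, DifferentiableOn ℂ B disk → (∀ z ∈ disk, ‖B z‖ ≤ 1) →
      δ ≤ ‖B a‖ → ∃ G : ℂ → ℂ, DifferentiableOn ℂ G disk ∧ (∀ z ∈ disk, ‖G z‖ ≤ C) ∧
      (∀ i ≤ k + m, i ≠ k → iteratedDeriv i (fun z => kern s a z * (B z * G z)) a = 0) ∧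
      (((1 - ‖a‖ ^ 2) ^ (s + k) : ℝ) : ℂ) *
        iteratedDeriv k (fun z => kern s a z * (B z * G z)) a = 1 := by
  induction m with
  | zero =>
    refine ⟨1 / δ, by positivity, fun a ha B hB _ hBa => ?_⟩
    obtain ⟨G, h1, h2, h3, h4⟩ := exists_lowest_order_jet s hδ k ha hB hBa
    exact ⟨G, h1, h2, fun i hi hik => h3 i (by omega), h4⟩
  | succ m ih =>
    obtain ⟨C, hC, h⟩ := ih
    obtain ⟨E, hE, hgrow⟩ := exists_norm_iteratedDeriv_kern_mul_le hs (k + m + 1)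
    refine ⟨C + E * C * (1 / δ), by positivity, fun a ha B hB hB1 hBa => ?_⟩
    obtain ⟨G, hG, hGC, hG0, hGk⟩ := h a ha B hB hB1 hBa
    obtain ⟨G', hG', hGC', hG0', hGk'⟩ := exists_lowest_order_jet s hδ (k + m + 1) ha hB hBa
    set f := fun z => kern s a z * (B z * G z) with hf
    set f' := fun z => kern s a z * (B z * G' z) with hf'
    set P : ℂ := (((1 - ‖a‖ ^ 2) ^ (s + (k + m + 1 : ℕ)) : ℝ) : ℂ) with hP
    -- Subtracting Λ f' cancels the derivative of order k+m+1 and leaves the lower ones alone, since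
    -- f' vanishes to that order. Λ is bounded uniformly by the Cauchy estimate.
    set Λ : ℂ := P * iteratedDeriv (k + m + 1) f a with hΛ
    have hfa : AnalyticAt ℂ f a :=
      analyticAt_of_mem_disk ((differentiableOn_kern s ha).mul (hB.mul hG)) ha
    have hfa' : AnalyticAt ℂ f' a :=
      analyticAt_of_mem_disk ((differentiableOn_kern s ha).mul (hB.mul hG')) ha
    have hΛle : ‖Λ‖ ≤ E * C := by
      have := hgrow a ha (fun z => B z * G z) C (hB.mul hG) hC.le (fun z hz => by
        rw [norm_mul]
        calc ‖B z‖ * ‖G z‖ ≤ 1 * C :=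
              mul_le_mul (hB1 z hz) (hGC z hz) (norm_nonneg _) zero_le_one
          _ = C := one_mul C) a ha
      have hpos := one_sub_norm_sq_pos ha
      rwa [hΛ, norm_mul, hP, Complex.norm_real, Real.norm_of_nonneg (by positivity)]
    have e : (fun z => kern s a z * (B z * (G z - Λ * G' z))) = fun z => f z - Λ * f' z := by
      ext z; rw [hf, hf']; ring
    have hD : ∀ i, iteratedDeriv i (fun z => f z - Λ * f' z) a =
        iteratedDeriv i f a - Λ * iteratedDeriv i f' a := fun i => by
      have hc : AnalyticAt ℂ (fun z => Λ * f' z) a := analyticAt_const.mul hfa'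
      rw [iteratedDeriv_fun_sub hfa.contDiffAt hc.contDiffAt,
        iteratedDeriv_const_mul_field]
    refine ⟨fun z => G z - Λ * G' z, hG.sub (hG'.const_mul Λ), fun z hz => ?_, ?_⟩
    · refine (norm_sub_le _ _).trans ?_
      rw [norm_mul]
      gcongr
      · exact hGC z hz
      · exact hGC' z hz
    · rw [e]
      simp only [hD]
      refine ⟨fun i hi hik => ?_, ?_⟩
      · by_cases him : i = k + m + 1
        · rw [him, hΛ]
          linear_combination (-iteratedDeriv (k + m + 1) f a) * hGk'
        · rw [hG0 i (by omega) hik, hG0' i (by omega)]; ring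
      · rw [hG0' k (by omega), mul_zero, sub_zero]; exact hGk

/-! ### Uniform independence at several points -/

lemma le_norm_mobius {a w : ℂ} (ha : a ∈ disk) (hw : w ∈ disk) {r : ℝ} (hr0 : 0 ≤ r) (hr1 : r ≤ 1)
    (h : r * (1 - ‖a‖) ≤ ‖w - a‖) : r / 3 ≤ ‖mobius w a‖ := by
  have ha1 := norm_lt_one_of_mem_disk ha
  have h0 : 0 < ‖1 - (starRingEnd ℂ) w * a‖ := norm_pos_iff.2 (one_sub_conj_mul_ne_zero hw ha)
  have h1 : ‖1 - (starRingEnd ℂ) w * a‖ ≤ 2 * (1 - ‖a‖) + ‖w - a‖ := by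
    have e : 1 - (starRingEnd ℂ) w * a =
        (1 - (starRingEnd ℂ) a * a) - (starRingEnd ℂ) (w - a) * a := by
      rw [map_sub]; ring
    rw [e]
    refine (norm_sub_le _ _).trans ?_
    rw [one_sub_conj_mul_self, Complex.norm_real, norm_mul, RCLike.norm_conj,
      Real.norm_of_nonneg (one_sub_norm_sq_pos ha).le]
    have := one_sub_norm_sq_le ha
    have h2 : ‖w - a‖ * ‖a‖ ≤ ‖w - a‖ * 1 := by gcongr
    linarith
  rw [mobius, norm_div, div_le_div_iff₀ (by norm_num) h0, norm_sub_rev a w]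
  nlinarith [norm_nonneg (w - a)]

lemma iteratedDeriv_kern_mul_prod_mobius_eq_zero {ι : Type*} [DecidableEq ι] (s : ℝ) {a : ℂ}
    (ha : a ∈ disk) {w : ι → ℂ} (hw : ∀ j, w j ∈ disk) (F : Finset ι) {G : ℂ → ℂ}
    (hG : DifferentiableOn ℂ G disk) {N i : ℕ} (hi : i < N) {j : ι} (hj : j ∈ F) :
    iteratedDeriv i (fun z => kern s a z * ((∏ l ∈ F, mobius (w l) z ^ N) * G z)) (w j) = 0 := by
  set g : ℂ → ℂ := fun z => kern s a z * ((∏ l ∈ F.erase j, mobius (w l) z ^ N) * G z) /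
    (1 - (starRingEnd ℂ) (w j) * z) ^ N with hg
  have hgd : DifferentiableOn ℂ g disk := by
    refine ((differentiableOn_kern s ha).mul (DifferentiableOn.mul ?_ hG)).div (by fun_prop)
      fun z hz => pow_ne_zero _ (one_sub_conj_mul_ne_zero (hw j) hz)
    exact DifferentiableOn.fun_finsetProd fun l _ => (differentiableOn_mobius (hw l)).pow N
  have e : (fun z => kern s a z * ((∏ l ∈ F, mobius (w l) z ^ N) * G z)) =
      fun z => (z - w j) ^ N * g z := by
    ext z
    rw [hg, ← Finset.mul_prod_erase F _ hj, mobius, div_pow]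
    ring
  rw [e, iteratedDeriv_sub_pow_mul (analyticAt_of_mem_disk hgd (hw j)) N hi.le, if_neg hi.ne]

/-- Uniform independence of the normalized functionals `f ↦ (1 - |w_j|²)^{s+j} f^{(j)}(w_j)`,
tested on bounded multiples of a kernel, when the points `w_j`, `j ∈ F`, are
hyperbolically separated from `w_k`. -/
lemma exists_test_function_of_separated {s : ℝ} (hs : 0 ≤ s) (n : ℕ) (k : Fin (n + 1)) (m : ℕ) :
    ∀ (F : Finset (Fin (n + 1))), Fᶜ.card = m → k ∉ F → ∀ r > 0, r ≤ 1 →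
    ∃ C > 0, ∀ w : Fin (n + 1) → ℂ, (∀ j, w j ∈ disk) → ∀ X : Fin (n + 1) → ℂ,
      (∀ j, ‖X j‖ ≤ ‖X k‖) → (∀ j ∈ F, r * (1 - ‖w k‖) ≤ ‖w j - w k‖) →
      ∃ H : ℂ → ℂ, DifferentiableOn ℂ H disk ∧ (∀ z ∈ disk, ‖H z‖ ≤ C) ∧
        ‖X k‖ ≤ 2 * ‖∑ j : Fin (n + 1), X j * ((((1 - ‖w j‖ ^ 2) ^ (s + ((j : ℕ) : ℝ)) : ℝ) : ℂ) *
          iteratedDeriv j (fun z => kern s (w k) z * H z) (w j))‖ := by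
  -- Induction on the number of indices not yet known to be far from `w k`; the base case is void,
  -- since k itself is never in F.
  induction m with
  | zero =>
    intro F hF hk
    rw [Finset.card_eq_zero, Finset.compl_eq_empty_iff] at hF
    exact absurd (hF ▸ Finset.mem_univ k) hk
  | succ m ih =>
    intro F hF hk r hr hr1
    obtain ⟨C₁, hC₁, hjet⟩ := exists_jet hs
      (δ := ∏ _j ∈ F, (r / 3) ^ (n + 1)) (Finset.prod_pos fun _ _ => by positivity) k n
    choose D hD hnear using fun j : ℕ => norm_iteratedDeriv_sub_le_of_growth s hs j
    set K : ℝ := ∑ j : Fin (n + 1), D j with hK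
    have hDK : ∀ j : Fin (n + 1), D j ≤ K := fun j =>
      Finset.single_le_sum (f := fun j : Fin (n + 1) => D j) (fun i _ => (hD i).le)
        (Finset.mem_univ j)
    have hK0 : 0 < K := (hD _).trans_le (hDK 0)
    set A : ℝ := 2 ^ s * C₁ with hA
    have hA0 : 0 < A := by positivity
    -- Chosen so that each index within τ contributes at most |X k|/(2(n+1)). It does not depend on
    -- w or X.
    set τ : ℝ := min (1 / 2) (1 / (2 * (n + 1) * (K * A))) with hτ
    have hτ0 : 0 < τ := by positivity
    have hτK : K * A * τ ≤ 1 / (2 * (n + 1)) := by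
      calc K * A * τ ≤ K * A * (1 / (2 * (n + 1) * (K * A))) := by
            gcongr; exact min_le_right _ _
        _ = _ := by field_simp
    -- The induction hypothesis is invoked for every candidate j before w is given, so that the sum
    -- of the constants works for all w. The value 1 for inadmissible j is a dummy.
    have hext : ∀ j : Fin (n + 1), ∃ C > 0, (j ∉ F ∧ j ≠ k) →
        ∀ w : Fin (n + 1) → ℂ, (∀ j, w j ∈ disk) → ∀ X : Fin (n + 1) → ℂ,
        (∀ j, ‖X j‖ ≤ ‖X k‖) →
        (∀ i ∈ insert j F, min r τ * (1 - ‖w k‖) ≤ ‖w i - w k‖) →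
        ∃ H : ℂ → ℂ, DifferentiableOn ℂ H disk ∧ (∀ z ∈ disk, ‖H z‖ ≤ C) ∧
          ‖X k‖ ≤ 2 * ‖∑ j : Fin (n + 1), X j *
            ((((1 - ‖w j‖ ^ 2) ^ (s + ((j : ℕ) : ℝ)) : ℝ) : ℂ) *
            iteratedDeriv j (fun z => kern s (w k) z * H z) (w j))‖ := by
      intro j
      by_cases hj : j ∉ F ∧ j ≠ k
      · obtain ⟨C, hC, h⟩ := ih (insert j F) (by
          rw [Finset.compl_insert, Finset.card_erase_of_mem (Finset.mem_compl.2 hj.1), hF]; rfl)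
          (by simp [hk, hj.2.symm]) (min r τ) (by positivity) ((min_le_left _ _).trans hr1)
        exact ⟨C, hC, fun _ => h⟩
      · exact ⟨1, one_pos, fun h => absurd h hj⟩
    choose C hC hext using hext
    have hCsum : ∀ j, C j ≤ ∑ j, C j := fun j =>
      Finset.single_le_sum (fun i _ => (hC i).le) (Finset.mem_univ j)
    have hCsum0 : 0 < ∑ j, C j := (hC 0).trans_le (hCsum 0)
    refine ⟨C₁ + ∑ j, C j, by positivity, fun w hw X hX hsep => ?_⟩
    by_cases hfar : ∃ j, (j ∉ F ∧ j ≠ k) ∧ τ * (1 - ‖w k‖) < ‖w j - w k‖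
    · obtain ⟨j, hj, hjτ⟩ := hfar
      have hk1 : 0 ≤ 1 - ‖w k‖ := by linarith [norm_lt_one_of_mem_disk (hw k)]
      obtain ⟨H, h1, h2, h3⟩ := hext j hj w hw X hX (fun i hi => by
        rcases Finset.mem_insert.1 hi with rfl | hi
        · exact (mul_le_mul_of_nonneg_right (min_le_right _ _) hk1).trans hjτ.le
        · exact (mul_le_mul_of_nonneg_right (min_le_left _ _) hk1).trans (hsep i hi))
      exact ⟨H, h1, fun z hz => (h2 z hz).trans (by linarith [hCsum j]), h3⟩
    · push Not at hfar
      -- Zeros of order n+1 annihilate every derivative of order at most n at the far points, while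
      -- |B| stays bounded below at `w k`.
      set B : ℂ → ℂ := fun z => ∏ j ∈ F, mobius (w j) z ^ (n + 1) with hB
      have hBd : DifferentiableOn ℂ B disk :=
        DifferentiableOn.fun_finsetProd fun l _ => (differentiableOn_mobius (hw l)).pow _
      have hB1 : ∀ z ∈ disk, ‖B z‖ ≤ 1 := fun z hz => by
        rw [hB, norm_prod]
        refine Finset.prod_le_one (fun _ _ => norm_nonneg _) fun j _ => ?_
        rw [norm_pow]
        exact pow_le_one₀ (norm_nonneg _)
          (norm_lt_one_of_mem_disk (mobius_mem_disk (hw j) hz)).le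
      have hBa : ∏ _j ∈ F, (r / 3) ^ (n + 1) ≤ ‖B (w k)‖ := by
        rw [hB, norm_prod]
        refine Finset.prod_le_prod (fun _ _ => by positivity) fun j hj => ?_
        rw [norm_pow]
        exact pow_le_pow_left₀ (by positivity)
          (le_norm_mobius (hw k) (hw j) hr.le hr1 (hsep j hj)) _
      obtain ⟨G, hG, hGC, hG0, hGk⟩ := hjet (w k) (hw k) B hBd hB1 hBa
      have hHC : ∀ z ∈ disk, ‖B z * G z‖ ≤ C₁ := fun z hz => by
        rw [norm_mul]
        calc ‖B z‖ * ‖G z‖ ≤ 1 * C₁ :=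
              mul_le_mul (hB1 z hz) (hGC z hz) (norm_nonneg _) zero_le_one
          _ = C₁ := one_mul C₁
      refine ⟨fun z => B z * G z, hBd.mul hG, fun z hz => (hHC z hz).trans (by linarith), ?_⟩
      set T : Fin (n + 1) → ℂ := fun j =>
        X j * ((((1 - ‖w j‖ ^ 2) ^ (s + ((j : ℕ) : ℝ)) : ℝ) : ℂ) *
          iteratedDeriv j (fun z => kern s (w k) z * (B z * G z)) (w j)) with hT
      have hTk : T k = X k := by
        simp only [hT]
        rw [hGk, mul_one]
      have hTj : ∀ j ∈ Finset.univ.erase k, ‖T j‖ ≤ ‖X k‖ * (1 / (2 * (n + 1))) := by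
        intro j hj
        have hjk : j ≠ k := Finset.ne_of_mem_erase hj
        have hpos := one_sub_norm_sq_pos (hw j)
        simp only [hT]
        rw [norm_mul, norm_mul, Complex.norm_real, Real.norm_of_nonneg (by positivity)]
        refine mul_le_mul (hX j) ?_ (by positivity) (norm_nonneg _)
        by_cases hjF : j ∈ F
        · rw [iteratedDeriv_kern_mul_prod_mobius_eq_zero s (hw k) hw F hG j.2 hjF, norm_zero,
            mul_zero]
          positivity
        · have h1 := hnear j (fun z => kern s (w k) z * (B z * G z)) A hA0.le
            ((differentiableOn_kern s (hw k)).mul (hBd.mul hG))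
            (fun z hz => norm_kern_mul_le hs (hw k) hHC hz) (w k) (hw k) (w j) (hw j) τ
            (min_le_left _ _) (hfar j ⟨hjF, hjk⟩)
          -- The jet was prescribed up to order k+n ≥ j, so the j-th derivative at `w k` is zero and
          -- closeness alone bounds the one at `w j`.
          rw [hG0 j (by omega) (by simpa [Fin.ext_iff] using hjk), sub_zero] at h1
          refine h1.trans (le_trans ?_ hτK)
          gcongr
          exact hDK j
      have hsum : ‖∑ j ∈ Finset.univ.erase k, T j‖ ≤ ‖X k‖ / 2 := by
        refine (norm_sum_le_of_le _ hTj).trans ?_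
        rw [Finset.sum_const, Finset.card_erase_of_mem (Finset.mem_univ k), Finset.card_univ,
          Fintype.card_fin, nsmul_eq_mul, Nat.add_sub_cancel]
        have : (n : ℝ) * (1 / (2 * (n + 1))) ≤ 1 / 2 := by
          rw [mul_one_div, div_le_div_iff₀ (by positivity) (by norm_num)]; linarith
        nlinarith [norm_nonneg (X k)]
      have htot : X k = ∑ j, T j - ∑ j ∈ Finset.univ.erase k, T j := by
        rw [← Finset.add_sum_erase _ _ (Finset.mem_univ k), hTk]; ring
      have h2 : ‖X k‖ ≤ ‖∑ j, T j‖ + ‖∑ j ∈ Finset.univ.erase k, T j‖ := by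
        conv_lhs => rw [htot]
        exact norm_sub_le _ _
      linarith

/-- Uniform independence of the functionals `f ↦ (1 - |w_j|²)^{s+j} f^{(j)}(w_j)`, `j ≤ n`. -/
lemma exists_test_function {s : ℝ} (hs : 0 ≤ s) (n : ℕ) :
    ∃ C > 0, ∀ w : Fin (n + 1) → ℂ, (∀ j, w j ∈ disk) → ∀ X : Fin (n + 1) → ℂ,
      ∃ a ∈ disk, ∃ H : ℂ → ℂ, DifferentiableOn ℂ H disk ∧ (∀ z ∈ disk, ‖H z‖ ≤ C) ∧
        ∀ k, ‖X k‖ ≤ 2 * ‖∑ j : Fin (n + 1), X j *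
          ((((1 - ‖w j‖ ^ 2) ^ (s + ((j : ℕ) : ℝ)) : ℝ) : ℂ) *
          iteratedDeriv j (fun z => kern s a z * H z) (w j))‖ := by
  -- Start with no far points, so that separation is vacuous; k will be an index with |X k| maximal.
  choose C hC h using fun k : Fin (n + 1) =>
    exists_test_function_of_separated hs n k (n + 1) ∅ (by simp) (by simp) 1 one_pos le_rfl
  refine ⟨∑ k, C k, (hC 0).trans_le
    (Finset.single_le_sum (fun i _ => (hC i).le) (Finset.mem_univ 0)), fun w hw X => ?_⟩
  obtain ⟨k, -, hk⟩ := Finset.exists_max_image Finset.univ (fun j => ‖X j‖) ⟨0, Finset.mem_univ _⟩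
  obtain ⟨H, h1, h2, h3⟩ := h k w hw X (fun j => hk j (Finset.mem_univ j)) (by simp)
  exact ⟨w k, hw k, H, h1, fun z hz => (h2 z hz).trans
    (Finset.single_le_sum (fun i _ => (hC i).le) (Finset.mem_univ k)),
    fun j => (hk j (Finset.mem_univ j)).trans h3⟩

/-! ### Necessity, and the equivalence -/

lemma exists_norm_le_of_orderBounded_sumDiffComp {p α : ℝ} (hp : 0 < p) (hα : -1 ≤ α) {n : ℕ}
    {u φ : Fin (n + 1) → ℂ → ℂ} (hφm : ∀ k, MapsTo (φ k) disk disk) {h : ℂ → ℝ}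
    (hle : ∀ f ∈ bergmanSpace p α, bergmanNorm p α f < 1 → ∀ z ∈ disk,
      ‖sumDiffComp n u φ f z‖ ≤ h z) :
    ∃ C > 0, ∀ z ∈ disk, ∀ k : Fin (n + 1),
      ‖u k z‖ / (1 - ‖φ k z‖ ^ 2) ^ ((2 + α) / p + ((k : ℕ) : ℝ)) ≤ C * h z := by
  have hs : 0 ≤ (2 + α) / p := div_nonneg (by linarith) hp.le
  set s := (2 + α) / p with hsdef
  obtain ⟨C₀, hC₀, hnorm⟩ := exists_bergmanNorm_kern_mul_le hp hα
  obtain ⟨C, hC, htest⟩ := exists_test_function hs n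
  -- This scaling makes the norm of the test function at most 1/2, hence strictly below 1.
  set ε : ℝ := (2 * (C₀ * C))⁻¹ with hε
  have hε0 : 0 < ε := by positivity
  refine ⟨2 * ε⁻¹, by positivity, fun z hz k => ?_⟩
  have hpos : ∀ j, 0 < 1 - ‖φ j z‖ ^ 2 := fun j => one_sub_norm_sq_pos (hφm j hz)
  -- With these coefficients the weights cancel, and the tested sum is T applied to the unscaled
  -- test function, evaluated at z. The function depends on z, the constants do not.
  obtain ⟨a, ha, H, hH, hHC, hk⟩ := htest (fun j => φ j z) (fun j => hφm j hz)
    (fun j => u j z / (((1 - ‖φ j z‖ ^ 2) ^ (s + ((j : ℕ) : ℝ)) : ℝ) : ℂ))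
  have hk := hk k
  set f : ℂ → ℂ := fun z => kern s a z * ((ε : ℂ) * H z) with hf
  have hfd : DifferentiableOn ℂ f disk := (differentiableOn_kern s ha).mul (hH.const_mul _)
  have hfn : bergmanNorm p α f < 1 := by
    refine (hnorm a ha (fun z => (ε : ℂ) * H z) (ε * C) (by positivity) fun z hz => ?_).trans_lt ?_
    · rw [norm_mul, Complex.norm_real, Real.norm_of_nonneg hε0.le]
      gcongr
      exact hHC z hz
    · rw [← ENNReal.ofReal_one, ENNReal.ofReal_lt_ofReal_iff one_pos]
      have : C₀ * (ε * C) = 1 / 2 := by rw [hε]; field_simp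
      rw [this]; norm_num
  have h1 := hle f ⟨hfd, hfn.trans ENNReal.one_lt_top⟩ hfn z hz
  have e : f = fun z => (ε : ℂ) * (kern s a z * H z) := by ext z; rw [hf]; ring
  have h2 : sumDiffComp n u φ f z = (ε : ℂ) * ∑ j : Fin (n + 1),
      u j z / (((1 - ‖φ j z‖ ^ 2) ^ (s + ((j : ℕ) : ℝ)) : ℝ) : ℂ) *
        ((((1 - ‖φ j z‖ ^ 2) ^ (s + ((j : ℕ) : ℝ)) : ℝ) : ℂ) *
          iteratedDeriv j (fun z => kern s a z * H z) (φ j z)) := by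
    rw [sumDiffComp, Finset.mul_sum]
    refine Finset.sum_congr rfl fun j _ => ?_
    have h0 : (((1 - ‖φ j z‖ ^ 2) ^ (s + ((j : ℕ) : ℝ)) : ℝ) : ℂ) ≠ 0 := by
      have := hpos j
      exact_mod_cast (Real.rpow_pos_of_pos this _).ne'
    rw [diffComp, e, iteratedDeriv_const_mul_field, ← mul_assoc (u j z / _), div_mul_cancel₀ _ h0]
    ring
  rw [h2, norm_mul, Complex.norm_real, Real.norm_of_nonneg hε0.le] at h1
  have hrp := Real.rpow_nonneg (hpos k).le (s + ((k : ℕ) : ℝ))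
  rw [norm_div, Complex.norm_real, Real.norm_of_nonneg hrp] at hk
  refine hk.trans ?_
  rw [mul_assoc]
  gcongr
  rwa [← div_eq_inv_mul, le_div_iff₀ hε0, mul_comm]

lemma lintegral_lt_top_of_orderBounded_sumDiffComp {p q α β : ℝ} (hp : 0 < p) (hq : 0 < q)
    (hα : -1 ≤ α) {n : ℕ} {u φ : Fin (n + 1) → ℂ → ℂ} (hφm : ∀ k, MapsTo (φ k) disk disk)
    (hT : OrderBounded p α q β (sumDiffComp n u φ)) (k : Fin (n + 1)) :
    ∫⁻ z, ENNReal.ofReal (‖u k z‖ ^ q /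
      (1 - ‖φ k z‖ ^ 2) ^ ((2 + α) * (q / p) + ((k : ℕ) : ℝ) * q)) ∂(dA β) < ⊤ := by
  obtain ⟨-, h, hh, hle⟩ := hT
  obtain ⟨C, hC, hb⟩ := exists_norm_le_of_orderBounded_sumDiffComp hp hα hφm hle
  have h1 := (hh.const_mul C).2
  rw [eLpNorm_lt_top_iff_lintegral_rpow_enorm_lt_top (by simpa using hq) ENNReal.ofReal_ne_top,
    ENNReal.toReal_ofReal hq.le] at h1
  refine (lintegral_mono_ae ?_).trans_lt h1
  filter_upwards [ae_mem_disk β] with z hz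
  have h0 := one_sub_norm_sq_pos (hφm k hz)
  rw [← ofReal_norm, ENNReal.ofReal_rpow_of_nonneg (norm_nonneg _) hq.le]
  refine ENNReal.ofReal_le_ofReal ?_
  have e : (2 + α) * (q / p) + ((k : ℕ) : ℝ) * q = ((2 + α) / p + ((k : ℕ) : ℝ)) * q := by
    field_simp
  rw [e, Real.rpow_mul h0.le, ← Real.div_rpow (norm_nonneg _) (by positivity)]
  exact Real.rpow_le_rpow (by positivity) ((hb z hz k).trans (le_abs_self _)) hq.le

end WeightedBergman

theorem theorem1 (p q α β : ℝ) (hp : 0 < p) (hq : 0 < q) (hα : -1 ≤ α) (hβ : -1 < β)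
    (n : ℕ) (hn : 1 ≤ n) (u φ : Fin (n + 1) → ℂ → ℂ)
    (hu : ∀ k, DifferentiableOn ℂ (u k) WeightedBergman.disk)
    (hφ : ∀ k, DifferentiableOn ℂ (φ k) WeightedBergman.disk)
    (hφmaps : ∀ k, Set.MapsTo (φ k) WeightedBergman.disk WeightedBergman.disk) :
    List.TFAE [
      WeightedBergman.OrderBounded p α q β (WeightedBergman.sumDiffComp n u φ),
      ∀ k : Fin (n + 1),
        WeightedBergman.OrderBounded p α q β (WeightedBergman.diffComp k (u k) (φ k)),
      ∀ k : Fin (n + 1),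
        ∫⁻ z, ENNReal.ofReal (‖u k z‖ ^ q /
          (1 - ‖φ k z‖ ^ 2) ^ ((2 + α) * (q / p) + ((k : ℕ) : ℝ) * q)) ∂(WeightedBergman.dA β)
          < ⊤] := by
  tfae_have 1 → 3 := fun h k =>
    WeightedBergman.lintegral_lt_top_of_orderBounded_sumDiffComp hp hq hα hφmaps h k
  tfae_have 3 → 2 := fun h k =>
    WeightedBergman.orderBounded_diffComp hp hq hα hβ k (hu k) (hφ k) (hφmaps k) (h k)
  tfae_have 2 → 1 := fun h => WeightedBergman.OrderBounded.sumDiffComp hβ h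
  tfae_finish
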